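/- Let $r,n\ge 1$, let $T^r=(S^1)^r$, and let $\rho:T^r\to GL(n,\mathbb C)$ be a continuous homomorphism such that every holomorphic function on $\mathbb C^n$ that is invariant under $\rho$ is constant. Let $D\subset\mathbb C^n$ be a bounded domain (a nonempty connected open set) with $0\in D$ that is invariant under $\rho$ (a bounded quasi-Reinhardt domain). Let $z=(z_1,\dots,z_n)$ be linear coordinates on $\mathbb C^n$ in which $\rho(\lambda)z=(\lambda^{a_1}z_1,\dots,\lambda^{a_n}z_n)$ for all $\lambda\in T^r$, where $a_i=(a_{i1},\dots,a_{ir})\in\mathbb Z^r$ and $\lambda^{a_i}=\lambda_1^{a_{i1}}\cdots\lambda_r^{a_{ir}}$. Assume that $a_{ij}\ge 0$ for all $i,j$, write $|a_i|=a_{i1}+\dots+a_{ir}$, and assume that $|a_1|\le\dots\le|a_n|$. Let $f$ be a biholomorphic map of $D$ onto itself with $f(0)=0$, and let $f_1,\dots,f_n$ be its components in the coordinates $z$. Then each $f_i$ is (the restriction to $D$ of) a polynomial in $z_1,\dots,z_n$ with $$\deg f_i\le\frac{|a_i|\,|a_n|}{|a_1|^2}\qquad(1\le i\le n),$$ and $\deg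 f=\max_i\deg f_i$ satisfies $$\deg f\le\frac{|a_n|^2}{|a_1|^2}.$$ -/

import Mathlib

open scoped Matrix

/-- The torus `T^r = (S¹)^r`. -/
abbrev Torus (r : ℕ) : Type := Fin r → Circle

/-- The character `t ↦ t^k = t_1^{k_1} ⋯ t_r^{k_r}` of the torus, for `k ∈ ℤ^r`. -/
noncomputable def torusChar {r : ℕ} (k : Fin r → ℤ) (t : Torus r) : ℂ :=
  ∏ j, (t j : ℂ) ^ k j

/-- A linear action `ρ : T^r → GL(n, ℂ)` on `ℂ^n` has only constant invariants: every holomorphic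
function on `ℂ^n` that is invariant under `ρ` is constant. -/
def OnlyConstantInvariants {r n : ℕ} (ρ : Torus r →* GL (Fin n) ℂ) : Prop :=
  ∀ h : (Fin n → ℂ) → ℂ, Differentiable ℂ h →
    (∀ (t : Torus r) (z : Fin n → ℂ), h ((ρ t : Matrix (Fin n) (Fin n) ℂ) *ᵥ z) = h z) →
    ∃ c : ℂ, ∀ z, h z = c

/-- `D ⊆ ℂ^n` is a quasi-Reinhardt domain with respect to `ρ`: the map `ρ` is a (continuous)
linear action of the torus on `ℂ^n` by holomorphic (linear) maps with only constant invariant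
holomorphic functions, and `D` is a domain that is invariant under `ρ`. -/
structure IsQuasiReinhardt {r n : ℕ} (ρ : Torus r →* GL (Fin n) ℂ) (D : Set (Fin n → ℂ)) :
    Prop where
  continuous_action : Continuous ρ
  only_constant_invariants : OnlyConstantInvariants ρ
  isOpen : IsOpen D
  isConnected : IsConnected D
  invariant : ∀ (t : Torus r), ∀ z ∈ D, (ρ t : Matrix (Fin n) (Fin n) ℂ) *ᵥ z ∈ D

/-- In the linear coordinates `(z_1, …, z_n)` on `ℂ^n` given by the basis `b`, the action is
`ρ(t) z = (t^{a_1} z_1, …, t^{a_n} z_n)`; the `a i : Fin r → ℤ` are the weights of `ρ`. -/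
def IsDiagonalWithWeights {r n : ℕ} (ρ : Torus r →* GL (Fin n) ℂ)
    (b : Module.Basis (Fin n) ℂ (Fin n → ℂ)) (a : Fin n → Fin r → ℤ) : Prop :=
  ∀ (t : Torus r) (z : Fin n → ℂ) (i : Fin n),
    b.repr ((ρ t : Matrix (Fin n) (Fin n) ℂ) *ᵥ z) i = torusChar (a i) t * b.repr z i

/-- The size `|k| = k_1 + ⋯ + k_r` of a weight (it is used for nonnegative `k` only). -/
def weightSize {r : ℕ} (k : Fin r → ℤ) : ℤ := ∑ j, k j

/-- `f` restricts to a holomorphic automorphism of the domain `D`: it is holomorphic on `D` and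
maps `D` to `D` bijectively, with a holomorphic inverse. -/
def IsHolAutomorphism {n : ℕ} (D : Set (Fin n → ℂ)) (f : (Fin n → ℂ) → (Fin n → ℂ)) : Prop :=
  DifferentiableOn ℂ f D ∧ Set.MapsTo f D D ∧
    ∃ g : (Fin n → ℂ) → (Fin n → ℂ),
      DifferentiableOn ℂ g D ∧ Set.MapsTo g D D ∧ Set.InvOn g f D D

/-- The degree of a polynomial map: the maximum of the (total) degrees of its components. -/
noncomputable def polyMapDegree {n : ℕ} (P : Fin n → MvPolynomial (Fin n) ℂ) : ℕ :=
  Finset.univ.sup fun i => (P i).totalDegree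

open Filter Topology Asymptotics Metric

/-! Put `m i = |a_i|`. The diagonal circle in the torus acts by `z_i ↦ t^{m i} z_i`, and every `m i`
is positive because an invariant coordinate would be a nonconstant invariant function. Let `G` be
the group of automorphisms of the bounded domain `D` that fix the origin.

For each order `k`, `G` acts linearly on `k`-jets of maps by `v ↦ dg(0)⁻¹ ∘ v ∘ g`. Since `D` is
bounded, Cauchy estimates make this action bounded, and it preserves the affine space of jets
tangent to the identity. A bounded group of linear maps that preserves a nonempty affine subspace
has a fixed point there (`exists_fixedPoint_of_pointwise_bounded`). The fixed jet `σ` satisfies `σ ∘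
g = dg(0) ∘ σ` to order `k` for all `g` in `G` simultaneously (`exists_linearizing_jet`).

Applied to the circle, this says that `σ_i` contains only monomials of weight `m i`
(`weight_eq_of_coeff_ne_zero`). Applied to `f`, with `A = df(0)` and `q_i = σ_i - z_i`, it reads
`f_i = (A σ)_i - q_i(f)` to order `k`. Every monomial of `q_i` has degree at least 2 and weight `m
i`, so it involves only variables of weight less than `m i`. Recursion on the weight therefore
expresses `f_i` as a polynomial to order `k`, and counting weights bounds its degree by `m i * m₁ /
m₀ ^ 2`, with `m₀`, `m₁` the extreme weights (`exists_jetEq_component_of_linearizing`). This bound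
does not depend on `k`, so the polynomials stabilize, and the identity theorem gives equality on `D`
(`exists_eqOn_component`). -/

/-! ### Fixed points of bounded groups of linear maps -/

theorem exists_fixedPoint_of_bounded {V : Type*} [NormedAddCommGroup V] [InnerProductSpace ℂ V]
    [FiniteDimensional ℂ V] (G : Set (V →ₗ[ℂ] V)) (hone : LinearMap.id ∈ G)
    (hmul : ∀ g ∈ G, ∀ h ∈ G, g ∘ₗ h ∈ G) (hinv : ∀ g ∈ G, ∃ h ∈ G, h ∘ₗ g = LinearMap.id)
    (C : ℝ) (hC : ∀ g ∈ G, ∀ v, ‖g v‖ ≤ C * ‖v‖) (W : Submodule ℂ V) (x₀ : V)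
    (hW : ∀ g ∈ G, ∀ v, v - x₀ ∈ W → g v - x₀ ∈ W) :
    ∃ v, v - x₀ ∈ W ∧ ∀ g ∈ G, g v = v := by
  have : ProperSpace V := FiniteDimensional.proper ℂ V
  have : Nonempty G := ⟨⟨_, hone⟩⟩
  have hCpos : ∃ c : ℝ, 0 < c ∧ ∀ g ∈ G, ∀ v, ‖g v‖ ≤ c * ‖v‖ :=
    ⟨max C 1, by positivity, fun g hg v => (hC g hg v).trans (by gcongr; exact le_max_left _ _)⟩
  obtain ⟨c, hc0, hc⟩ := hCpos
  have hlow : ∀ g ∈ G, ∀ v, ‖v‖ ≤ c * ‖g v‖ := by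
    intro g hg v
    obtain ⟨h, hh, hgh⟩ := hinv g hg
    have := hc h hh (g v)
    rwa [← LinearMap.comp_apply, hgh, LinearMap.id_apply] at this
  -- The fixed point is a minimizer over `x₀ + W` of the largest norm along the orbit. This function
  -- is continuous and coercive, and does not increase along orbits.
  set N : V → ℝ := fun v => ⨆ g : G, ‖(g : V →ₗ[ℂ] V) v‖ with hN
  have hbdd : ∀ v, BddAbove (Set.range fun g : G => ‖(g : V →ₗ[ℂ] V) v‖) := fun v =>
    ⟨c * ‖v‖, by rintro _ ⟨g, rfl⟩; exact hc g g.2 v⟩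
  have hle : ∀ g ∈ G, ∀ v, ‖g v‖ ≤ N v := fun g hg v => le_ciSup (hbdd v) ⟨g, hg⟩
  have hlip : ∀ x y, N x ≤ N y + c * ‖x - y‖ := by
    intro x y
    refine ciSup_le fun g => ?_
    have h1 : (g : V →ₗ[ℂ] V) x = (g : V →ₗ[ℂ] V) y + (g : V →ₗ[ℂ] V) (x - y) := by
      rw [← map_add]; congr 1; abel
    rw [h1]
    exact (norm_add_le _ _).trans (add_le_add (hle g g.2 y) (hc g g.2 _))
  have hcont : Continuous N := by
    refine (LipschitzWith.of_le_add_mul ⟨c, hc0.le⟩ fun x y => ?_).continuous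
    rw [dist_eq_norm]; exact hlip x y
  have hself : ∀ v, ‖v‖ ≤ N v := fun v => hle _ hone v
  set K : Set V := {v | v - x₀ ∈ W} with hK
  have hKc : IsClosed K := (Submodule.closed_of_finiteDimensional W).preimage (by fun_prop)
  have hx₀ : x₀ ∈ K := by simp [hK]
  obtain ⟨x, hxK, hx⟩ := hcont.continuousOn.exists_isMinOn' (s := K) hKc hx₀ (by
    refine Filter.Eventually.filter_mono inf_le_left ?_
    filter_upwards [(tendsto_norm_cocompact_atTop (E := V)).eventually_ge_atTop (N x₀)] with v hv
    exact hv.trans (hself v))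
  refine ⟨x, hxK, fun h hh => ?_⟩
  by_contra hne
  have hyK : h x ∈ K := hW h hh x hxK
  have hNy : N (h x) ≤ N x := ciSup_le fun g => hle _ (hmul g g.2 h hh) x
  set y := h x
  have hmid : (1 / 2 : ℂ) • (x + y) ∈ K := by
    have : (1 / 2 : ℂ) • (x + y) - x₀ = (1 / 2 : ℂ) • ((x - x₀) + (y - x₀)) := by
      module
    change _ ∈ W
    rw [this]
    exact W.smul_mem _ (W.add_mem hxK hyK)
  have hmin : N x ≤ N ((1 / 2 : ℂ) • (x + y)) := hx hmid
  have hd : 0 < ‖x - y‖ := norm_pos_iff.2 (sub_ne_zero.2 (Ne.symm hne))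
  have hN0 : 0 ≤ N x := (norm_nonneg _).trans (hself x)
  -- If `h` moved the minimizer `x` to `y ≠ x`, the parallelogram law would lower `N ^ 2` at the
  -- midpoint by at least `δ`. The gain is uniform in `g` because `‖g (x - y)‖ ≥ ‖x - y‖ / c`.
  set δ := (‖x - y‖ / c) ^ 2 / 4 with hδ
  have hδ0 : 0 < δ := by positivity
  have key : ∀ g ∈ G, ‖g ((1 / 2 : ℂ) • (x + y))‖ ^ 2 ≤ N x ^ 2 - δ := by
    intro g hg
    have h1 := parallelogram_law_with_norm ℂ (g x) (g y)
    have h2 : ‖g ((1 / 2 : ℂ) • (x + y))‖ = ‖g x + g y‖ / 2 := by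
      rw [map_smul, map_add, norm_smul]; norm_num; ring
    have h3 : ‖x - y‖ / c ≤ ‖g x - g y‖ := by
      rw [div_le_iff₀ hc0, mul_comm, ← map_sub]; exact hlow g hg _
    have h4 : (‖x - y‖ / c) ^ 2 ≤ ‖g x - g y‖ ^ 2 := by gcongr
    have h5 : ‖g x‖ ^ 2 ≤ N x ^ 2 := by gcongr; exact hle g hg x
    have h6 : ‖g y‖ ^ 2 ≤ N x ^ 2 := by gcongr; exact (hle g hg y).trans hNy
    rw [h2, hδ]; nlinarith
  have h7 : N ((1 / 2 : ℂ) • (x + y)) ≤ √(N x ^ 2 - δ) :=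
    ciSup_le fun g => Real.le_sqrt_of_sq_le (key g g.2)
  have h8 : √(N x ^ 2 - δ) < N x := by
    rw [Real.sqrt_lt' ]
    · linarith
    · have := key _ hone
      have := sq_nonneg ‖LinearMap.id (R := ℂ) ((1 / 2 : ℂ) • (x + y))‖
      by_contra hcon
      have : N x = 0 := le_antisymm (not_lt.1 hcon) hN0
      nlinarith
  linarith

/-- A separating family of functionals spans the dual of a finite-dimensional space, so all
coordinates of each orbit are bounded. Testing on a basis makes the bound uniform in operator norm,
and the Euclidean case applies after a choice of coordinates. -/
theorem exists_fixedPoint_of_pointwise_bounded {V X : Type*} [AddCommGroup V] [Module ℂ V]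
    [FiniteDimensional ℂ V] (G : Set (V →ₗ[ℂ] V)) (hone : LinearMap.id ∈ G)
    (hmul : ∀ g ∈ G, ∀ h ∈ G, g ∘ₗ h ∈ G) (hinv : ∀ g ∈ G, ∃ h ∈ G, h ∘ₗ g = LinearMap.id)
    (ev : X → Module.Dual ℂ V) (hev : ∀ v, (∀ x, ev x v = 0) → v = 0)
    (hb : ∀ x v, ∃ B : ℝ, ∀ g ∈ G, ‖ev x (g v)‖ ≤ B) (W : Submodule ℂ V) (x₀ : V)
    (hW : ∀ g ∈ G, ∀ v, v - x₀ ∈ W → g v - x₀ ∈ W) :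
    ∃ v, v - x₀ ∈ W ∧ ∀ g ∈ G, g v = v := by
  have hspan : Submodule.span ℂ (Set.range ev) = ⊤ := by
    rw [← Subspace.dualCoannihilator_dualAnnihilator_eq (W := Submodule.span ℂ (Set.range ev))]
    have : (Submodule.span ℂ (Set.range ev)).dualCoannihilator = ⊥ := by
      rw [eq_bot_iff]
      intro v hv
      rw [Submodule.mem_dualCoannihilator] at hv
      exact hev v fun x => hv _ (Submodule.subset_span ⟨x, rfl⟩)
    rw [this, Submodule.dualAnnihilator_bot]
  have hall : ∀ ℓ : Module.Dual ℂ V, ∀ v, ∃ B : ℝ, ∀ g ∈ G, ‖ℓ (g v)‖ ≤ B := by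
    intro ℓ v
    have hℓ : ℓ ∈ Submodule.span ℂ (Set.range ev) := hspan ▸ Submodule.mem_top
    induction hℓ using Submodule.span_induction with
    | mem _ h => obtain ⟨x, rfl⟩ := h; exact hb x v
    | zero => exact ⟨0, by simp⟩
    | add a b _ _ ha hb =>
      obtain ⟨A, hA⟩ := ha
      obtain ⟨B, hB⟩ := hb
      exact ⟨A + B, fun g hg => (norm_add_le _ _).trans (add_le_add (hA g hg) (hB g hg))⟩
    | smul c a _ ha =>
      obtain ⟨A, hA⟩ := ha
      refine ⟨‖c‖ * A, fun g hg => ?_⟩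
      rw [LinearMap.smul_apply, norm_smul]
      gcongr
      exact hA g hg
  set d := Module.finrank ℂ V
  set β := Module.finBasis ℂ V
  set e : V ≃ₗ[ℂ] EuclideanSpace ℂ (Fin d) :=
    β.equivFun.trans (WithLp.linearEquiv 2 ℂ (Fin d → ℂ)).symm
  have hnorm : ∀ v, ∃ A : ℝ, 0 ≤ A ∧ ∀ g ∈ G, ‖e (g v)‖ ≤ A := by
    intro v
    have : ∀ i, ∃ B : ℝ, ∀ g ∈ G, ‖β.coord i (g v)‖ ≤ B := fun i => hall _ v
    choose B hB using this
    refine ⟨√(∑ i, B i ^ 2), Real.sqrt_nonneg _, fun g hg => ?_⟩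
    rw [EuclideanSpace.norm_eq]
    refine Real.sqrt_le_sqrt (Finset.sum_le_sum fun i _ => ?_)
    have := hB i g hg
    have h2 : (e (g v)) i = β.coord i (g v) := rfl
    rw [h2]
    gcongr
  choose A hA0 hA using hnorm
  have huni : ∀ g ∈ G, ∀ x, ‖e (g (e.symm x))‖ ≤ (∑ j, A (β j)) * ‖x‖ := by
    intro g hg x
    have hx : e.symm x = ∑ j, x j • β j := by
      simp only [e, LinearEquiv.trans_symm, LinearEquiv.symm_symm, LinearEquiv.trans_apply,
        Module.Basis.equivFun_symm_apply]
      rfl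
    rw [hx, map_sum, map_sum, Finset.sum_mul]
    refine norm_sum_le_of_le _ fun j _ => ?_
    rw [map_smul, map_smul, norm_smul, mul_comm]
    exact mul_le_mul (hA _ g hg) (PiLp.norm_apply_le x j) (norm_nonneg _) (hA0 _)
  obtain ⟨v, hv, hfix⟩ := exists_fixedPoint_of_bounded
    ((fun g : V →ₗ[ℂ] V => e.toLinearMap ∘ₗ g ∘ₗ e.symm.toLinearMap) '' G)
    ⟨_, hone, by ext x; simp⟩
    (by
      rintro _ ⟨g, hg, rfl⟩ _ ⟨h, hh, rfl⟩
      exact ⟨_, hmul g hg h hh, by ext x; simp⟩)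
    (by
      rintro _ ⟨g, hg, rfl⟩
      obtain ⟨h, hh, hgh⟩ := hinv g hg
      refine ⟨_, ⟨h, hh, rfl⟩, ?_⟩
      ext1 x
      have : h (g (e.symm x)) = e.symm x := LinearMap.congr_fun hgh _
      simp [this])
    (∑ j, A (β j)) (by rintro _ ⟨g, hg, rfl⟩ x; exact huni g hg x)
    (W.comap e.symm.toLinearMap) (e x₀)
    (by
      rintro _ ⟨g, hg, rfl⟩ x hx
      simp only [Submodule.mem_comap, LinearEquiv.coe_coe, map_sub, LinearEquiv.symm_apply_apply,
        LinearMap.comp_apply] at hx ⊢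
      exact hW g hg _ hx)
  refine ⟨e.symm v, by simpa using hv, fun g hg => ?_⟩
  have := hfix _ ⟨g, hg, rfl⟩
  simp only [LinearMap.comp_apply, LinearEquiv.coe_coe] at this
  rw [LinearEquiv.eq_symm_apply]
  exact this

/-! ### Taylor expansion in a single variable -/

theorem norm_update_le_max {n : ℕ} (z : Fin n → ℂ) (i : Fin n) (ζ : ℂ) :
    ‖Function.update z i ζ‖ ≤ max ‖z‖ ‖ζ‖ := by
  refine (pi_norm_le_iff_of_nonneg (by positivity)).2 fun l => ?_
  rcases eq_or_ne l i with rfl | hl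
  · simp
  · rw [Function.update_of_ne hl]
    exact (norm_le_pi_norm z l).trans (le_max_left _ _)

theorem hasFDerivAt_update_left {n : ℕ} (i : Fin n) (ζ : ℂ) (z : Fin n → ℂ) :
    HasFDerivAt (fun z : Fin n → ℂ => Function.update z i ζ)
      (ContinuousLinearMap.pi fun l =>
        if l = i then 0 else ContinuousLinearMap.proj (R := ℂ) (φ := fun _ : Fin n => ℂ) l) z := by
  rw [hasFDerivAt_pi']
  intro l
  rcases eq_or_ne l i with rfl | hl
  · simp only [Function.update_self]
    exact (hasFDerivAt_const ζ z).congr_fderiv (by ext v; simp)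
  · simp only [Function.update_of_ne hl]
    exact (ContinuousLinearMap.proj (R := ℂ) (φ := fun _ : Fin n => ℂ) l).hasFDerivAt.congr_fderiv
      (by ext v; simp [hl])

theorem norm_pi_ite_proj_le {n : ℕ} (i : Fin n) :
    ‖(ContinuousLinearMap.pi fun l =>
        if l = i then 0 else ContinuousLinearMap.proj (R := ℂ) (φ := fun _ : Fin n => ℂ) l :
        (Fin n → ℂ) →L[ℂ] (Fin n → ℂ))‖ ≤ 1 := by
  refine ContinuousLinearMap.opNorm_le_bound _ zero_le_one fun v => ?_
  rw [one_mul]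
  refine (pi_norm_le_iff_of_nonneg (norm_nonneg _)).2 fun l => ?_
  by_cases hl : l = i
  · simp [hl]
  · simpa [hl] using norm_le_pi_norm v l

theorem norm_fderiv_le_of_norm_le {E F : Type*} [NormedAddCommGroup E] [NormedSpace ℂ E]
    [NormedAddCommGroup F] [NormedSpace ℂ F] {h : E → F} {w : E} {δ M : ℝ} (hδ : 0 < δ)
    (hh : DifferentiableOn ℂ h (ball w δ)) (hM : ∀ z ∈ ball w δ, ‖h z‖ ≤ M) :
    ‖fderiv ℂ h w‖ ≤ 2 * M / δ := by
  refine Complex.norm_fderiv_le_div_of_mapsTo_ball hh (fun z hz => ?_) hδ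
  rw [mem_closedBall, dist_eq_norm]
  have := norm_sub_le (h z) (h w)
  linarith [hM z hz, hM w (mem_ball_self hδ)]

/-- Needed to expand variable by variable: the Taylor coefficients in `z_i` must again be
holomorphic. Differentiation under the integral is justified by the Cauchy bound `2 * M / δ` on the
derivative. -/
theorem differentiableOn_circleIntegral_update {n : ℕ} (i : Fin n) {h : (Fin n → ℂ) → ℂ}
    {R s M : ℝ} (hs : 0 < s) (hsR : s < R) (hh : DifferentiableOn ℂ h (ball 0 R))
    (hM : ∀ z ∈ ball (0 : Fin n → ℂ) R, ‖h z‖ ≤ M) (j : ℕ) :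
    DifferentiableOn ℂ
      (fun z => ∮ ζ in C(0, s), (ζ⁻¹) ^ (j + 1) • h (Function.update z i ζ)) (ball 0 R) := by
  intro z₀ hz₀
  rw [mem_ball_zero_iff] at hz₀
  set r := max ‖z₀‖ s with hr
  have hrR : r < R := max_lt hz₀ hsR
  -- Half the gap: for `z` within `δ` of `z₀`, the updated point has norm less than `r + δ`, and the
  -- `δ`-ball around it still lies in the ball of radius `R = r + 2 * δ`.
  set δ := (R - r) / 2 with hδ
  have hδ0 : 0 < δ := by rw [hδ]; linarith
  have hM0 : 0 ≤ M := (norm_nonneg _).trans (hM 0 (mem_ball_self (hs.trans hsR)))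
  have hmem : ∀ z ∈ ball z₀ δ, ∀ t : ℝ,
      ‖Function.update z i (circleMap 0 s t)‖ < r + δ := by
    intro z hz t
    refine (norm_update_le_max _ _ _).trans_lt (max_lt ?_ ?_)
    · have h1 : ‖z‖ ≤ ‖z₀‖ + ‖z - z₀‖ := by
        have := norm_add_le z₀ (z - z₀); rwa [add_sub_cancel] at this
      rw [mem_ball, dist_eq_norm] at hz
      linarith [le_max_left ‖z₀‖ s]
    · rw [norm_circleMap_zero, abs_of_pos hs]
      linarith [le_max_right ‖z₀‖ s]
  have hsub : ∀ z ∈ ball z₀ δ, ∀ t : ℝ,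
      ball (Function.update z i (circleMap 0 s t)) δ ⊆ ball 0 R := by
    intro z hz t
    refine ball_subset_ball' ?_
    rw [dist_zero_right]
    have := hmem z hz t
    rw [hδ] at this ⊢
    linarith
  have hin : ∀ z ∈ ball z₀ δ, ∀ t : ℝ,
      Function.update z i (circleMap 0 s t) ∈ ball (0 : Fin n → ℂ) R := fun z hz t =>
    hsub z hz t (mem_ball_self hδ0)
  set c : ℝ → ℂ := fun t => deriv (circleMap 0 s) t * ((circleMap 0 s t)⁻¹) ^ (j + 1) with hc
  have hcc : Continuous c := by
    have h0 : ∀ t, circleMap 0 s t ≠ 0 := fun t => circleMap_ne_center hs.ne'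
    simp only [hc, deriv_circleMap]
    have := continuous_circleMap 0 s
    fun_prop (disch := exact h0 _)
  set U : (Fin n → ℂ) →L[ℂ] (Fin n → ℂ) := ContinuousLinearMap.pi fun l =>
    if l = i then 0 else ContinuousLinearMap.proj (R := ℂ) (φ := fun _ : Fin n => ℂ) l with hU
  have hcont : ∀ z ∈ ball z₀ δ,
      Continuous fun t : ℝ => c t • h (Function.update z i (circleMap 0 s t)) := by
    intro z hz
    refine hcc.smul ?_
    refine hh.continuousOn.comp_continuous ?_ (hin z hz)
    exact continuous_const.update i (continuous_circleMap 0 s)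
  have key := intervalIntegral.hasFDerivAt_integral_of_dominated_of_fderiv_le (𝕜 := ℂ)
    (μ := MeasureTheory.volume) (a := 0) (b := 2 * Real.pi) (s := ball z₀ δ) (x₀ := z₀)
    (F := fun z t => c t • h (Function.update z i (circleMap 0 s t)))
    (F' := fun z t => c t • (fderiv ℂ h (Function.update z i (circleMap 0 s t))).comp U)
    (bound := fun t => ‖c t‖ * (2 * M / δ))
    (ball_mem_nhds _ hδ0)
    (by
      filter_upwards [ball_mem_nhds z₀ hδ0] with z hz
      exact (hcont z hz).aestronglyMeasurable)
    ((hcont z₀ (mem_ball_self hδ0)).intervalIntegrable _ _)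
    (by
      refine Measurable.aestronglyMeasurable ?_
      refine hcc.measurable.smul ?_
      have h1 : Measurable fun t : ℝ => Function.update z₀ i (circleMap 0 s t) :=
        (continuous_const.update i (continuous_circleMap 0 s)).measurable
      have h2 : Continuous fun A : (Fin n → ℂ) →L[ℂ] ℂ => A.comp U := by fun_prop
      exact h2.measurable.comp ((measurable_fderiv ℂ h).comp h1))
    (by
      refine Eventually.of_forall fun t _ z hz => ?_
      rw [norm_smul]
      gcongr
      refine (ContinuousLinearMap.opNorm_comp_le _ _).trans ?_
      have h1 := norm_fderiv_le_of_norm_le hδ0 (hh.mono (hsub z hz t))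
        fun w hw => hM w (hsub z hz t hw)
      have h2 : ‖U‖ ≤ 1 := norm_pi_ite_proj_le i
      calc _ ≤ (2 * M / δ) * 1 := by gcongr
        _ = _ := mul_one _)
    ((by fun_prop : Continuous fun t => ‖c t‖ * (2 * M / δ)).intervalIntegrable _ _)
    (by
      refine Eventually.of_forall fun t _ z hz => ?_
      have h1 : DifferentiableAt ℂ h (Function.update z i (circleMap 0 s t)) :=
        hh.differentiableAt (isOpen_ball.mem_nhds (hin z hz t))
      exact (h1.hasFDerivAt.comp z (hasFDerivAt_update_left i _ z)).const_smul (c t))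
  refine (key.differentiableAt.congr_of_eventuallyEq ?_).differentiableWithinAt
  refine Eventually.of_forall fun z => ?_
  simp only [circleIntegral, hc, smul_eq_mul, mul_assoc]

/-- The `j`-th Taylor coefficient of `h` in the `i`-th variable. -/
noncomputable def partialTaylorCoeff {n : ℕ} (i : Fin n) (s : ℝ) (j : ℕ) (h : (Fin n → ℂ) → ℂ)
    (z : Fin n → ℂ) : ℂ :=
  (2 * Real.pi * Complex.I)⁻¹ •
    ∮ ζ in C(0, s), (ζ⁻¹) ^ (j + 1) • h (Function.update z i ζ)

theorem inv_sub_eq_sum_add {ζ w : ℂ} (hζ : ζ ≠ 0) (hw : ζ - w ≠ 0) (k : ℕ) :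
    (ζ - w)⁻¹ = (∑ j ∈ Finset.range k, w ^ j * (ζ⁻¹) ^ (j + 1)) + (w * ζ⁻¹) ^ k * (ζ - w)⁻¹ := by
  induction k with
  | zero => simp
  | succ k ih =>
    have h1 : (w * ζ⁻¹) ^ k * (ζ - w)⁻¹ =
        w ^ k * (ζ⁻¹) ^ (k + 1) + (w * ζ⁻¹) ^ (k + 1) * (ζ - w)⁻¹ := by
      have h2 : (ζ - w)⁻¹ = ζ⁻¹ + w * ζ⁻¹ * (ζ - w)⁻¹ := by field_simp; ring
      nth_rewrite 1 [h2]
      ring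
    rw [Finset.sum_range_succ, add_assoc, ← h1]
    exact ih

/-- The Cauchy kernel is expanded as a finite geometric sum plus remainder. The factor 2 comes from
`‖ζ - z i‖ ≥ s / 2` on the circle. -/
theorem norm_sub_sum_partialTaylorCoeff_le {n : ℕ} (i : Fin n) {h : (Fin n → ℂ) → ℂ}
    {R s M : ℝ} (hs : 0 < s) (hsR : s < R) (hh : DifferentiableOn ℂ h (ball 0 R))
    (hM : ∀ z ∈ ball (0 : Fin n → ℂ) R, ‖h z‖ ≤ M) (k : ℕ) {z : Fin n → ℂ} (hz : ‖z‖ < R)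
    (hzi : ‖z i‖ < s / 2) :
    ‖h z - ∑ j ∈ Finset.range k, z i ^ j * partialTaylorCoeff i s j h z‖ ≤
      (‖z i‖ / s) ^ k * (2 * M) := by
  set φ : ℂ → ℂ := fun ζ => h (Function.update z i ζ) with hφ
  have hin : ∀ ζ ∈ ball (0 : ℂ) R, Function.update z i ζ ∈ ball (0 : Fin n → ℂ) R := by
    intro ζ hζ
    rw [mem_ball_zero_iff] at hζ ⊢
    exact (norm_update_le_max _ _ _).trans_lt (max_lt hz hζ)
  have hφd : DifferentiableOn ℂ φ (ball 0 R) := by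
    refine hh.comp (fun ζ _ => ?_) hin
    exact (hasFDerivAt_update z ζ).differentiableAt.differentiableWithinAt
  have hcl : closedBall (0 : ℂ) s ⊆ ball 0 R := closedBall_subset_ball hsR
  have hφc : ContinuousOn φ (sphere 0 s) :=
    hφd.continuousOn.mono (sphere_subset_closedBall.trans hcl)
  have hne : ∀ ζ ∈ sphere (0 : ℂ) s, ζ ≠ 0 := fun ζ hζ => ne_of_mem_sphere hζ hs.ne'
  have hlow : ∀ ζ ∈ sphere (0 : ℂ) s, s / 2 ≤ ‖ζ - z i‖ := by
    intro ζ hζ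
    rw [mem_sphere_zero_iff_norm] at hζ
    have := norm_sub_norm_le ζ (z i)
    linarith
  have hne' : ∀ ζ ∈ sphere (0 : ℂ) s, ζ - z i ≠ 0 := fun ζ hζ =>
    norm_pos_iff.1 (lt_of_lt_of_le (by positivity) (hlow ζ hζ))
  have hcauchy : h z = (2 * Real.pi * Complex.I : ℂ)⁻¹ •
      ∮ ζ in C(0, s), (ζ - z i)⁻¹ • φ ζ := by
    rw [Complex.two_pi_I_inv_smul_circleIntegral_sub_inv_smul_of_differentiable_on_off_countable
      Set.countable_empty (f := φ) (w := z i)]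
    · simp [hφ]
    · rw [mem_ball_zero_iff]; linarith
    · exact hφd.continuousOn.mono hcl
    · intro x hx
      exact hφd.differentiableAt (isOpen_ball.mem_nhds (hcl (ball_subset_closedBall hx.1)))
  have hci1 : ∀ j, CircleIntegrable (fun ζ => z i ^ j * ((ζ⁻¹) ^ (j + 1) • φ ζ)) 0 s := by
    intro j
    refine ContinuousOn.circleIntegrable hs.le ?_
    refine continuousOn_const.mul (ContinuousOn.fun_smul ?_ hφc)
    exact (continuousOn_id.inv₀ hne).pow _
  have hci2 : CircleIntegrable (fun ζ => (z i * ζ⁻¹) ^ k * (ζ - z i)⁻¹ * φ ζ) 0 s := by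
    refine ContinuousOn.circleIntegrable hs.le ?_
    refine ContinuousOn.mul (ContinuousOn.mul ?_ ?_) hφc
    · exact (continuousOn_const.mul (continuousOn_id.inv₀ hne)).pow _
    · exact (continuousOn_id.sub continuousOn_const).inv₀ hne'
  have hsplit : (∮ ζ in C(0, s), (ζ - z i)⁻¹ • φ ζ) =
      (∑ j ∈ Finset.range k, z i ^ j * ∮ ζ in C(0, s), (ζ⁻¹) ^ (j + 1) • φ ζ) +
        ∮ ζ in C(0, s), (z i * ζ⁻¹) ^ k * (ζ - z i)⁻¹ * φ ζ := by
    simp_rw [← smul_eq_mul (z i ^ _) (circleIntegral _ _ _), ← circleIntegral.integral_smul]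
    rw [← circleIntegral.integral_fun_sum, ← circleIntegral.integral_add]
    · refine circleIntegral.integral_congr hs.le fun ζ hζ => ?_
      simp only [smul_eq_mul]
      nth_rewrite 1 [inv_sub_eq_sum_add (hne ζ hζ) (hne' ζ hζ) k]
      rw [add_mul, Finset.sum_mul]
      simp only [mul_assoc]
    · exact CircleIntegrable.fun_sum _ fun j _ => hci1 j
    · exact hci2
    · exact fun j _ => hci1 j
  have hrem : h z - ∑ j ∈ Finset.range k, z i ^ j * partialTaylorCoeff i s j h z =
      (2 * Real.pi * Complex.I : ℂ)⁻¹ •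
        ∮ ζ in C(0, s), (z i * ζ⁻¹) ^ k * (ζ - z i)⁻¹ * φ ζ := by
    rw [hcauchy, hsplit, smul_add, Finset.smul_sum, sub_eq_iff_eq_add, add_comm]
    congr 1
    refine Finset.sum_congr rfl fun j _ => ?_
    simp only [partialTaylorCoeff, smul_eq_mul, hφ]
    ring
  rw [hrem]
  have hM0 : 0 ≤ M := (norm_nonneg _).trans (hM 0 (mem_ball_self (hs.trans hsR)))
  refine (circleIntegral.norm_two_pi_i_inv_smul_integral_le_of_norm_le_const hs.le
    (C := (‖z i‖ / s) ^ k * (s / 2)⁻¹ * M) fun ζ hζ => ?_).trans_eq ?_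
  · have h1 : ‖ζ‖ = s := mem_sphere_zero_iff_norm.1 hζ
    rw [norm_mul, norm_mul, norm_pow, norm_mul, norm_inv, norm_inv, h1, ← div_eq_mul_inv]
    refine mul_le_mul (mul_le_mul_of_nonneg_left ?_ (by positivity)) ?_ (by positivity)
      (by positivity)
    · exact inv_anti₀ (by positivity) (hlow ζ hζ)
    · exact hM _ (hin ζ (hcl (sphere_subset_closedBall hζ)))
  · field_simp

/-! ### Calculus of jets -/

/-- Two maps have the same `k`-jet at the origin. -/
def JetEq {E F : Type*} [NormedAddCommGroup E] [NormedAddCommGroup F] (k : ℕ) (u v : E → F) :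
    Prop :=
  (fun z => u z - v z) =o[𝓝 0] fun z => ‖z‖ ^ k

namespace JetEq

section basic

variable {E F : Type*} [NormedAddCommGroup E] [NormedAddCommGroup F] {k l : ℕ} {u v w : E → F}

theorem of_eventuallyEq (h : u =ᶠ[𝓝 0] v) : JetEq k u v := by
  refine (isLittleO_zero _ _).congr' ?_ EventuallyEq.rfl
  filter_upwards [h] with z hz
  rw [hz, sub_self]

theorem refl (u : E → F) : JetEq k u u := of_eventuallyEq EventuallyEq.rfl

theorem symm (h : JetEq k u v) : JetEq k v u := by
  refine h.neg_left.congr_left fun z => ?_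
  abel

theorem trans (h : JetEq k u v) (h' : JetEq k v w) : JetEq k u w := by
  refine (IsLittleO.add h h').congr_left fun z => ?_
  abel

theorem add {u' v' : E → F} (h : JetEq k u v) (h' : JetEq k u' v') :
    JetEq k (fun z => u z + u' z) (fun z => v z + v' z) := by
  refine (IsLittleO.add h h').congr_left fun z => ?_
  dsimp only
  abel

theorem sub {u' v' : E → F} (h : JetEq k u v) (h' : JetEq k u' v') :
    JetEq k (fun z => u z - u' z) (fun z => v z - v' z) := by
  refine (IsLittleO.sub h h').congr_left fun z => ?_
  dsimp only
  abel

theorem sum {ι : Type*} {s : Finset ι} {u v : ι → E → F} (h : ∀ i ∈ s, JetEq k (u i) (v i)) :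
    JetEq k (fun z => ∑ i ∈ s, u i z) (fun z => ∑ i ∈ s, v i z) := by
  refine (IsLittleO.sum h).congr_left fun z => ?_
  simp only [Finset.sum_sub_distrib, Finset.sum_apply]

theorem mono (hkl : k ≤ l) (h : JetEq l u v) : JetEq k u v := by
  refine IsLittleO.trans_isBigO h ?_
  refine IsBigO.of_bound 1 ?_
  filter_upwards [ball_mem_nhds (0 : E) one_pos] with z hz
  rw [mem_ball_zero_iff] at hz
  simp only [norm_pow, norm_norm, one_mul]
  exact pow_le_pow_of_le_one (norm_nonneg _) hz.le hkl

theorem comp {H : Type*} [NormedAddCommGroup H] [NormedSpace ℂ E] [NormedSpace ℂ H] {g : H → E}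
    (h : JetEq k u v) (hg : DifferentiableAt ℂ g 0) (hg0 : g 0 = 0) :
    JetEq k (fun z => u (g z)) (fun z => v (g z)) := by
  have h1 : Tendsto g (𝓝 0) (𝓝 0) := by
    have := hg.continuousAt.tendsto; rwa [hg0] at this
  have h2 : (fun z => ‖g z‖) =O[𝓝 0] fun z => ‖z‖ := by
    have := hg.isBigO_sub
    simpa [hg0] using this.norm_norm
  exact (IsLittleO.comp_tendsto h h1).trans_isBigO (h2.pow k)

theorem clm_apply {F' : Type*} [NormedAddCommGroup F'] [NormedSpace ℂ F] [NormedSpace ℂ F']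
    (A : F →L[ℂ] F') (h : JetEq k u v) : JetEq k (fun z => A (u z)) (fun z => A (v z)) := by
  refine (A.isBigO_comp (fun z => u z - v z) (𝓝 0) |>.trans_isLittleO h).congr_left fun z => ?_
  rw [map_sub]

end basic

section mul

variable {E : Type*} [NormedAddCommGroup E] {k : ℕ} {u v u' v' : E → ℂ}

theorem mul (h : JetEq k u v) (h' : JetEq k u' v') (hu : u =O[𝓝 0] fun _ => (1 : ℝ))
    (hv : v' =O[𝓝 0] fun _ => (1 : ℝ)) :
    JetEq k (fun z => u z * u' z) (fun z => v z * v' z) := by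
  have h1 := hu.mul_isLittleO h'
  have h2 := IsLittleO.mul_isBigO h hv
  simp only [one_mul, mul_one] at h1 h2
  refine (h1.add h2).congr_left fun z => ?_
  ring

theorem prod {ι : Type*} {s : Finset ι} {u v : ι → E → ℂ} (h : ∀ i ∈ s, JetEq k (u i) (v i))
    (hu : ∀ i ∈ s, ContinuousAt (u i) 0) (hv : ∀ i ∈ s, ContinuousAt (v i) 0) :
    JetEq k (fun z => ∏ i ∈ s, u i z) (fun z => ∏ i ∈ s, v i z) := by
  classical
  induction s using Finset.induction_on with
  | empty => simpa using JetEq.refl _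
  | insert i s hi ih =>
    simp only [Finset.prod_insert hi]
    simp only [Finset.forall_mem_insert] at h hu hv
    exact mul h.1 (ih h.2 hu.2 hv.2) (hu.1.tendsto.isBigO_one ℝ)
      ((tendsto_finsetProd s fun j hj => hv.2 j hj).isBigO_one ℝ)

theorem pow (h : JetEq k u v) (hu : ContinuousAt u 0) (hv : ContinuousAt v 0) (d : ℕ) :
    JetEq k (fun z => u z ^ d) (fun z => v z ^ d) := by
  have := prod (s := Finset.range d) (fun _ _ => h) (fun _ _ => hu) (fun _ _ => hv)
  simpa using this

end mul

theorem pi_iff {E : Type*} [NormedAddCommGroup E] {ι : Type*} [Fintype ι] {k : ℕ}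
    {u v : E → ι → ℂ} : JetEq k u v ↔ ∀ i, JetEq k (fun z => u z i) (fun z => v z i) :=
  isLittleO_pi

end JetEq

/-! ### Taylor polynomials in several variables -/

theorem isBigO_one_of_continuousAt {E F : Type*} [NormedAddCommGroup E] [NormedAddCommGroup F]
    {u : E → F} (h : ContinuousAt u 0) : u =O[𝓝 0] fun _ => (1 : ℝ) :=
  h.tendsto.isBigO_one ℝ

theorem norm_partialTaylorCoeff_le {n : ℕ} (i : Fin n) {h : (Fin n → ℂ) → ℂ}
    {R s M : ℝ} (hs : 0 < s) (hsR : s < R)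
    (hM : ∀ z ∈ ball (0 : Fin n → ℂ) R, ‖h z‖ ≤ M) (j : ℕ) {z : Fin n → ℂ} (hz : ‖z‖ < R) :
    ‖partialTaylorCoeff i s j h z‖ ≤ s * ((s⁻¹) ^ (j + 1) * M) := by
  refine circleIntegral.norm_two_pi_i_inv_smul_integral_le_of_norm_le_const hs.le fun ζ hζ => ?_
  have h1 : ‖ζ‖ = s := mem_sphere_zero_iff_norm.1 hζ
  rw [norm_smul, norm_pow, norm_inv, h1]
  gcongr
  refine hM _ (mem_ball_zero_iff.2 ?_)
  exact (norm_update_le_max _ _ _).trans_lt (max_lt hz (h1 ▸ hsR))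

theorem isLittleO_norm_pow {E : Type*} [NormedAddCommGroup E] {k l : ℕ} (h : k < l) :
    (fun z : E => ‖z‖ ^ l) =o[𝓝 0] fun z => ‖z‖ ^ k := by
  have := (isLittleO_pow_pow (𝕜 := ℝ) h).comp_tendsto (tendsto_norm_zero (E := E))
  exact this

theorem jetEq_sum_partialTaylorCoeff {n : ℕ} (i : Fin n) {h : (Fin n → ℂ) → ℂ}
    {R s M : ℝ} (hs : 0 < s) (hsR : s < R) (hh : DifferentiableOn ℂ h (ball 0 R))
    (hM : ∀ z ∈ ball (0 : Fin n → ℂ) R, ‖h z‖ ≤ M) (k : ℕ) :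
    JetEq k h fun z => ∑ j ∈ Finset.range (k + 1), z i ^ j * partialTaylorCoeff i s j h z := by
  have hM0 : 0 ≤ M := (norm_nonneg _).trans (hM 0 (mem_ball_self (hs.trans hsR)))
  refine IsBigO.trans_isLittleO (g := fun z : Fin n → ℂ => ‖z‖ ^ (k + 1)) ?_
    (isLittleO_norm_pow (Nat.lt_succ_self k))
  refine IsBigO.of_bound ((1 / s) ^ (k + 1) * (2 * M)) ?_
  filter_upwards [ball_mem_nhds (0 : Fin n → ℂ) (half_pos hs)] with z hz
  rw [mem_ball_zero_iff] at hz
  have hzi := norm_le_pi_norm z i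
  refine (norm_sub_sum_partialTaylorCoeff_le i hs hsR hh hM (k + 1) (by linarith)
    (hzi.trans_lt hz)).trans ?_
  rw [norm_pow, norm_norm]
  calc (‖z i‖ / s) ^ (k + 1) * (2 * M) ≤ (‖z‖ / s) ^ (k + 1) * (2 * M) := by gcongr
    _ = _ := by rw [div_pow, div_pow]; ring

/-- Induction on the set of variables that `h` depends on: the Taylor coefficients in `z_i` no
longer depend on `z_i`, and remain bounded and holomorphic on the same ball. -/
theorem exists_mvPolynomial_jetEq_of_dependsOn {n : ℕ} {R : ℝ} (hR : 0 < R) (k : ℕ)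
    (S : Finset (Fin n)) : ∀ (h : (Fin n → ℂ) → ℂ) (M : ℝ), DifferentiableOn ℂ h (ball 0 R) →
    (∀ z ∈ ball (0 : Fin n → ℂ) R, ‖h z‖ ≤ M) →
    (∀ z ∈ ball (0 : Fin n → ℂ) R, ∀ w ∈ ball (0 : Fin n → ℂ) R,
      (∀ i ∈ S, z i = w i) → h z = h w) →
    ∃ T : MvPolynomial (Fin n) ℂ, JetEq k h fun z => MvPolynomial.eval z T := by
  induction S using Finset.induction_on with
  | empty =>
    intro h M _ _ hdep
    refine ⟨MvPolynomial.C (h 0), JetEq.of_eventuallyEq ?_⟩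
    filter_upwards [ball_mem_nhds (0 : Fin n → ℂ) hR] with z hz
    rw [MvPolynomial.eval_C]
    exact hdep z hz 0 (mem_ball_self hR) (by simp)
  | insert i S hi ih =>
    intro h M hh hM hdep
    have hs : 0 < R / 2 := half_pos hR
    have hsR : R / 2 < R := half_lt_self hR
    have hd : ∀ j, DifferentiableOn ℂ (partialTaylorCoeff i (R / 2) j h) (ball 0 R) := fun j =>
      (differentiableOn_circleIntegral_update i hs hsR hh hM j).fun_const_smul _
    have hT : ∀ j, ∃ T : MvPolynomial (Fin n) ℂ,
        JetEq k (partialTaylorCoeff i (R / 2) j h) fun z => MvPolynomial.eval z T := by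
      intro j
      refine ih _ _ (hd j) (fun z hz => norm_partialTaylorCoeff_le i hs hsR hM j
        (mem_ball_zero_iff.1 hz)) fun z hz w hw hzw => ?_
      rw [mem_ball_zero_iff] at hz hw
      unfold partialTaylorCoeff
      congr 1
      refine circleIntegral.integral_congr hs.le fun ζ hζ => ?_
      have h1 : ‖ζ‖ < R := by rw [mem_sphere_zero_iff_norm.1 hζ]; exact hsR
      congr 1
      refine hdep _ (mem_ball_zero_iff.2 ((norm_update_le_max _ _ _).trans_lt (max_lt hz h1))) _
        (mem_ball_zero_iff.2 ((norm_update_le_max _ _ _).trans_lt (max_lt hw h1))) fun l hl => ?_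
      rcases eq_or_ne l i with rfl | hli
      · simp
      · rw [Function.update_of_ne hli, Function.update_of_ne hli]
        exact hzw l ((Finset.mem_insert.1 hl).resolve_left hli)
    choose T hT using hT
    refine ⟨∑ j ∈ Finset.range (k + 1), MvPolynomial.X i ^ j * T j, ?_⟩
    refine (jetEq_sum_partialTaylorCoeff i hs hsR hh hM k).trans ?_
    simp only [map_sum, map_mul, map_pow, MvPolynomial.eval_X]
    refine JetEq.sum fun j _ => JetEq.mul (JetEq.refl _) (hT j) ?_ ?_
    · exact isBigO_one_of_continuousAt ((continuous_apply i).pow j).continuousAt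
    · exact isBigO_one_of_continuousAt (MvPolynomial.continuous_eval _).continuousAt

theorem norm_prod_pow_le {n : ℕ} (z : Fin n → ℂ) (α : Fin n →₀ ℕ) :
    ‖∏ i, z i ^ α i‖ ≤ ‖z‖ ^ α.degree := by
  rw [norm_prod, Finsupp.degree_eq_sum, ← Finset.prod_pow_eq_pow_sum]
  refine Finset.prod_le_prod (fun _ _ => norm_nonneg _) fun i _ => ?_
  rw [norm_pow]
  gcongr
  exact norm_le_pi_norm z i

theorem eval_eq_sum_support {n : ℕ} (z : Fin n → ℂ) (P : MvPolynomial (Fin n) ℂ) :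
    MvPolynomial.eval z P = ∑ α ∈ P.support, P.coeff α * ∏ i, z i ^ α i :=
  MvPolynomial.eval_eq' z P

theorem exists_jetEq_totalDegree_le {n : ℕ} (k : ℕ) (P : MvPolynomial (Fin n) ℂ) :
    ∃ Q : MvPolynomial (Fin n) ℂ, Q.totalDegree ≤ k ∧
      (∀ α : Fin n →₀ ℕ, α.degree ≤ k → Q.coeff α = P.coeff α) ∧
      JetEq k (fun z => MvPolynomial.eval z P) fun z => MvPolynomial.eval z Q := by
  classical
  refine ⟨∑ α ∈ P.support with α.degree ≤ k, MvPolynomial.monomial α (P.coeff α), ?_, ?_, ?_⟩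
  · refine MvPolynomial.totalDegree_finsetSum_le fun α hα => ?_
    refine (MvPolynomial.totalDegree_monomial_le _ _).trans ?_
    exact (Finset.mem_filter.1 hα).2
  · intro α hα
    rw [MvPolynomial.coeff_sum]
    simp only [MvPolynomial.coeff_monomial, Finset.sum_ite_eq', Finset.mem_filter, hα, and_true,
      MvPolynomial.mem_support_iff, ite_not]
    split_ifs with h
    · exact h.symm
    · rfl
  · have h1 : ∀ z, MvPolynomial.eval z P - MvPolynomial.eval z
        (∑ α ∈ P.support with α.degree ≤ k, MvPolynomial.monomial α (P.coeff α)) =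
        ∑ α ∈ P.support with ¬ α.degree ≤ k, P.coeff α * ∏ i, z i ^ α i := by
      intro z
      rw [eval_eq_sum_support, ← Finset.sum_filter_add_sum_filter_not _ (fun α => α.degree ≤ k),
        map_sum]
      simp [MvPolynomial.eval_monomial, Finsupp.prod_fintype]
    unfold JetEq
    simp only [h1]
    refine IsLittleO.fun_sum fun α hα => ?_
    have hα' := (Finset.mem_filter.1 hα).2
    have hO : (fun z : Fin n → ℂ => ∏ i, z i ^ α i) =O[𝓝 0] fun z => ‖z‖ ^ α.degree := by
      refine IsBigO.of_bound 1 (Eventually.of_forall fun z => ?_)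
      rw [one_mul, norm_pow, norm_norm]
      exact norm_prod_pow_le z α
    exact (hO.trans_isLittleO (isLittleO_norm_pow (not_le.1 hα'))).const_mul_left _

/-- Taylor polynomials of holomorphic functions of several variables. -/
theorem exists_taylor_mvPolynomial {n : ℕ} {R M : ℝ} (hR : 0 < R) (k : ℕ) {h : (Fin n → ℂ) → ℂ}
    (hh : DifferentiableOn ℂ h (ball 0 R)) (hM : ∀ z ∈ ball (0 : Fin n → ℂ) R, ‖h z‖ ≤ M) :
    ∃ T : MvPolynomial (Fin n) ℂ, T.totalDegree ≤ k ∧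
      JetEq k h fun z => MvPolynomial.eval z T := by
  obtain ⟨T, hT⟩ := exists_mvPolynomial_jetEq_of_dependsOn hR k Finset.univ h M hh hM
    fun z _ w _ hzw => by rw [funext fun i => hzw i (Finset.mem_univ i)]
  obtain ⟨Q, hQ, -, hTQ⟩ := exists_jetEq_totalDegree_le k T
  exact ⟨Q, hQ, hT.trans hTQ⟩

/-! ### Cauchy estimates for jets, uniqueness and the identity theorem -/

theorem iteratedDeriv_polynomial_eval_zero (q : Polynomial ℂ) (j : ℕ) :
    iteratedDeriv j (fun ζ => q.eval ζ) 0 = j.factorial * q.coeff j := by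
  have h1 : ∀ j, iteratedDeriv j (fun ζ => q.eval ζ) =
      fun ζ => (Polynomial.derivative^[j] q).eval ζ := by
    intro j
    induction j with
    | zero => simp
    | succ j ih =>
      rw [iteratedDeriv_succ, ih]
      ext ζ
      rw [Polynomial.deriv, Function.iterate_succ_apply']
  rw [h1]
  dsimp only
  rw [← Polynomial.coeff_zero_eq_eval_zero, Polynomial.coeff_iterate_derivative]
  simp [Nat.descFactorial_self]

/-- Cauchy's estimate on a circle of radius `δ' ≤ 1` bounds the derivative by `c * δ' ^ k / δ' ^ j ≤
c`, with `c` arbitrary. -/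
theorem iteratedDeriv_eq_zero_of_jetEq {e : ℂ → ℂ} {k j : ℕ} (hj : j ≤ k) {ρ : ℝ} (hρ : 0 < ρ)
    (he : DifferentiableOn ℂ e (ball 0 ρ)) (h : JetEq k e 0) : iteratedDeriv j e 0 = 0 := by
  rw [← norm_le_zero_iff]
  refine le_of_forall_pos_le_add fun c hc => ?_
  rw [zero_add]
  have hc' : 0 < c / j.factorial := by positivity
  have h1 := h.def hc'
  obtain ⟨δ, hδ0, hδ⟩ := Metric.eventually_nhds_iff_ball.1 h1
  set δ' := min (min (δ / 2) (ρ / 2)) 1 with hδ'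
  have h0 : 0 < δ' := by positivity
  have hlt : δ' < δ := by
    have := (min_le_left (min (δ / 2) (ρ / 2)) 1).trans (min_le_left _ _); linarith
  have hlt' : δ' < ρ := by
    have := (min_le_left (min (δ / 2) (ρ / 2)) 1).trans (min_le_right _ _); linarith
  have hle : δ' ≤ 1 := min_le_right _ _
  have h2 := Complex.norm_iteratedDeriv_le_of_forall_mem_sphere_norm_le (c := 0) (f := e)
    (C := c / j.factorial * δ' ^ k) j h0
    ((he.mono (closedBall_subset_ball hlt')).diffContOnCl_ball subset_rfl) (fun z hz => by
      have hz' : ‖z‖ = δ' := mem_sphere_zero_iff_norm.1 hz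
      have := hδ z (mem_ball_zero_iff.2 (hz' ▸ hlt))
      simpa [hz', abs_of_pos h0] using this)
  refine h2.trans ?_
  rw [div_le_iff₀ (by positivity)]
  have h3 : δ' ^ k ≤ δ' ^ j := pow_le_pow_of_le_one h0.le hle hj
  calc (j.factorial : ℝ) * (c / j.factorial * δ' ^ k) = c * δ' ^ k := by field_simp
    _ ≤ c * δ' ^ j := by gcongr

/-- Reduces statements at `z` to one variable on the disc `ζ ↦ ζ • z`; a radius above 1 makes room
for the point `ζ = 1` and the unit circle. -/
theorem exists_one_lt_forall_smul_mem_ball {E : Type*} [NormedAddCommGroup E] [NormedSpace ℂ E]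
    {R : ℝ} {z : E} (hz : z ∈ ball 0 R) :
    ∃ ρ : ℝ, 1 < ρ ∧ ∀ ζ ∈ ball (0 : ℂ) ρ, ζ • z ∈ ball (0 : E) R := by
  rw [mem_ball_zero_iff] at hz
  rcases (norm_nonneg z).eq_or_lt with h0 | h0
  · refine ⟨2, by norm_num, fun ζ _ => ?_⟩
    rw [mem_ball_zero_iff, norm_smul, ← h0, mul_zero, h0]; exact hz
  · refine ⟨R / ‖z‖, (one_lt_div h0).2 hz, fun ζ hζ => ?_⟩
    rw [mem_ball_zero_iff] at hζ ⊢
    rw [norm_smul]; exact (lt_div_iff₀ h0).1 hζ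

/-- On the line through `z`, the `k + 1` coefficients of `P` are Taylor coefficients of `h`, each at
most `M` by Cauchy's estimate on the unit circle. This bounds the action on jets, and with `M = 0`
it gives uniqueness of jets. -/
theorem norm_eval_le_of_jetEq {n k : ℕ} {P : MvPolynomial (Fin n) ℂ} (hP : P.totalDegree ≤ k)
    {h : (Fin n → ℂ) → ℂ} {R M : ℝ} (hh : DifferentiableOn ℂ h (ball 0 R))
    (hM : ∀ z ∈ ball (0 : Fin n → ℂ) R, ‖h z‖ ≤ M)
    (hj : JetEq k h fun z => MvPolynomial.eval z P) {z : Fin n → ℂ} (hz : z ∈ ball 0 R) :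
    ‖MvPolynomial.eval z P‖ ≤ (k + 1) * M := by
  set q : Polynomial ℂ := MvPolynomial.aeval (fun i => Polynomial.C (z i) * Polynomial.X) P with hq
  have hqe : ∀ ζ : ℂ, q.eval ζ = MvPolynomial.eval (ζ • z) P := by
    intro ζ
    rw [hq, ← Polynomial.coe_evalRingHom, MvPolynomial.aeval_def, MvPolynomial.hom_eval₂,
      MvPolynomial.eval, MvPolynomial.coe_eval₂Hom]
    congr 1
    · ext1 x
      rw [RingHom.comp_apply, ← Polynomial.C_eq_algebraMap]
      simp only [Polynomial.coe_evalRingHom, Polynomial.eval_C, RingHom.id_apply]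
    · ext1 i
      simp only [Polynomial.coe_evalRingHom, Polynomial.eval_mul,
        Polynomial.eval_C, Polynomial.eval_X, Pi.smul_apply, smul_eq_mul, mul_comm]
  have hqd : q.natDegree ≤ k := by
    rw [hq, ← mul_one k]
    refine (MvPolynomial.aeval_natDegree_le _ hP _ fun i => ?_)
    exact (Polynomial.natDegree_C_mul_le _ _).trans Polynomial.natDegree_X_le
  obtain ⟨ρ, hρ1, hρ⟩ := exists_one_lt_forall_smul_mem_ball hz
  have hρ0 : 0 < ρ := one_pos.trans hρ1
  have hl : Differentiable ℂ fun ζ : ℂ => ζ • z := by fun_prop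
  have hφ : DifferentiableOn ℂ (fun ζ : ℂ => h (ζ • z)) (ball 0 ρ) :=
    hh.comp hl.differentiableOn hρ
  have hcoef : ∀ j ≤ k, ‖q.coeff j‖ ≤ M := by
    intro j hjk
    have hjet : JetEq k ((fun ζ : ℂ => h (ζ • z)) - fun ζ => q.eval ζ) 0 := by
      have h1 := hj.comp (hl 0) (zero_smul ℂ z)
      refine IsLittleO.congr_left h1 fun ζ => ?_
      simp [hqe]
    have hzero := iteratedDeriv_eq_zero_of_jetEq hjk hρ0 (hφ.sub q.differentiable.differentiableOn)
      hjet
    have han : ContDiffAt ℂ j (fun ζ : ℂ => h (ζ • z)) 0 :=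
      (hφ.analyticAt (ball_mem_nhds 0 hρ0)).contDiffAt
    have hq' : ContDiffAt ℂ j (fun ζ : ℂ => q.eval ζ) 0 :=
      (q.differentiable.differentiableOn.analyticAt univ_mem).contDiffAt
    rw [iteratedDeriv_sub han hq', sub_eq_zero,
      iteratedDeriv_polynomial_eval_zero] at hzero
    have h2 := Complex.norm_iteratedDeriv_le_of_forall_mem_sphere_norm_le (c := 0)
      (f := fun ζ : ℂ => h (ζ • z)) (C := M) j one_pos
      ((hφ.mono (closedBall_subset_ball hρ1)).diffContOnCl_ball subset_rfl)
      (fun ζ hζ => hM _ (hρ ζ (sphere_subset_ball hρ1 hζ)))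
    rw [hzero, norm_mul, one_pow, div_one, Complex.norm_natCast] at h2
    exact le_of_mul_le_mul_left h2 (by positivity)
  have h1 := hqe 1
  rw [one_smul] at h1
  rw [← h1, Polynomial.eval_eq_sum_range' (Nat.lt_succ_of_le hqd)]
  refine (norm_sum_le_of_le (f := fun j => q.coeff j * 1 ^ j) (n := fun _ => M) _
    fun j hj => ?_).trans_eq ?_
  · rw [one_pow, mul_one]
    exact hcoef j (Nat.lt_succ_iff.1 (Finset.mem_range.1 hj))
  · simp

theorem eq_zero_of_jetEq_zero {n k : ℕ} {P : MvPolynomial (Fin n) ℂ} (hP : P.totalDegree ≤ k)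
    (hj : JetEq k (fun z => MvPolynomial.eval z P) 0) : P = 0 := by
  refine MvPolynomial.funext fun z => ?_
  have := norm_eval_le_of_jetEq (R := ‖z‖ + 1) (M := 0) (h := 0) hP
    (differentiableOn_const 0) (by simp) hj.symm (z := z) (by simp)
  simpa using this

theorem eq_of_jetEq {n k : ℕ} {P Q : MvPolynomial (Fin n) ℂ} (hP : P.totalDegree ≤ k)
    (hQ : Q.totalDegree ≤ k)
    (hj : JetEq k (fun z => MvPolynomial.eval z P) fun z => MvPolynomial.eval z Q) : P = Q := by
  rw [← sub_eq_zero]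
  refine eq_zero_of_jetEq_zero ((MvPolynomial.totalDegree_sub _ _).trans (max_le hP hQ)) ?_
  refine IsLittleO.congr_left hj fun z => ?_
  simp

/-- A function that is holomorphic on a ball and flat to infinite order at the centre vanishes. -/
theorem eq_zero_of_forall_jetEq_zero {n : ℕ} {h : (Fin n → ℂ) → ℂ} {R : ℝ}
    (hh : DifferentiableOn ℂ h (ball 0 R)) (hj : ∀ k, JetEq k h 0) {z : Fin n → ℂ}
    (hz : z ∈ ball 0 R) : h z = 0 := by
  obtain ⟨ρ, hρ1, hρ⟩ := exists_one_lt_forall_smul_mem_ball hz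
  have hρ0 : 0 < ρ := one_pos.trans hρ1
  have hl : Differentiable ℂ fun ζ : ℂ => ζ • z := by fun_prop
  have hφ : DifferentiableOn ℂ (fun ζ : ℂ => h (ζ • z)) (ball 0 ρ) :=
    hh.comp hl.differentiableOn hρ
  have hzero : ∀ j, iteratedDeriv j (fun ζ : ℂ => h (ζ • z)) 0 = 0 := fun j =>
    iteratedDeriv_eq_zero_of_jetEq le_rfl hρ0 hφ ((hj j).comp (hl 0) (zero_smul ℂ z))
  have h1 := Complex.hasSum_taylorSeries_on_ball (f := fun ζ : ℂ => h (ζ • z)) hφ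
    (z := 1) (by simpa using hρ1)
  simp only [hzero, smul_zero] at h1
  simpa using h1.unique hasSum_zero

/-- The points near which `h` vanishes form an open set. It is relatively closed in `D`, since
flatness at `w` forces vanishing on a whole ball around `w`, of a radius that does not shrink as `w`
approaches a limit point. -/
theorem eqOn_zero_of_isPreconnected {n : ℕ} {h : (Fin n → ℂ) → ℂ} {D : Set (Fin n → ℂ)}
    (hD : IsOpen D) (hc : IsPreconnected D) (hh : DifferentiableOn ℂ h D) {z₀ : Fin n → ℂ}
    (hz₀ : z₀ ∈ D) (h0 : h =ᶠ[𝓝 z₀] 0) : ∀ z ∈ D, h z = 0 := by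
  have hU : IsOpen {z | h =ᶠ[𝓝 z] 0} := isOpen_setOfPred_eventually_nhds
  have hsub : D ⊆ {z | h =ᶠ[𝓝 z] 0} := by
    refine hc.subset_of_closure_inter_subset hU ⟨z₀, hz₀, h0⟩ ?_
    rintro c ⟨hcl, hcD⟩
    obtain ⟨R, hR, hRD⟩ := Metric.isOpen_iff.1 hD c hcD
    obtain ⟨w, hw, hcw⟩ := Metric.mem_closure_iff.1 hcl (R / 2) (half_pos hR)
    have hsub : ball w (R / 2) ⊆ D := (ball_subset_ball' (by
      rw [dist_comm]; linarith)).trans hRD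
    have hd : DifferentiableOn ℂ (fun z => h (w + z)) (ball 0 (R / 2)) := by
      refine hh.comp (by fun_prop) fun z hz => hsub ?_
      rwa [mem_ball, dist_eq_norm, add_sub_cancel_left, ← mem_ball_zero_iff]
    have hflat : (fun z => h (w + z)) =ᶠ[𝓝 0] 0 := by
      have h1 : Tendsto (fun z => w + z) (𝓝 0) (𝓝 w) := by
        have : Continuous fun z : Fin n → ℂ => w + z := by fun_prop
        simpa using this.tendsto 0
      exact h1.eventually hw
    have hvan : ∀ z ∈ ball w (R / 2), h z = 0 := by
      intro z hz
      have := eq_zero_of_forall_jetEq_zero hd (fun k => JetEq.of_eventuallyEq hflat)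
        (z := z - w) (by rwa [mem_ball_zero_iff, ← dist_eq_norm])
      simpa using this
    exact Filter.mem_of_superset (isOpen_ball.mem_nhds (mem_ball.2 hcw)) hvan
  exact fun z hz => (hsub hz).eq_of_nhds

/-! ### Automorphisms fixing the origin -/

/-- `g` is an automorphism of `D` fixing the origin, with inverse `g'`. -/
structure IsCenteredAut {n : ℕ} (D : Set (Fin n → ℂ)) (g g' : (Fin n → ℂ) → (Fin n → ℂ)) :
    Prop where
  differentiableOn : DifferentiableOn ℂ g D
  differentiableOn_inv : DifferentiableOn ℂ g' D
  mapsTo : Set.MapsTo g D D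
  mapsTo_inv : Set.MapsTo g' D D
  left_inv : ∀ z ∈ D, g' (g z) = z
  right_inv : ∀ z ∈ D, g (g' z) = z
  map_zero : g 0 = 0
  map_zero_inv : g' 0 = 0

namespace IsCenteredAut

variable {n : ℕ} {D : Set (Fin n → ℂ)} {g g' h h' : (Fin n → ℂ) → (Fin n → ℂ)}

theorem id (D : Set (Fin n → ℂ)) : IsCenteredAut D (fun z => z) (fun z => z) where
  differentiableOn := differentiableOn_id
  differentiableOn_inv := differentiableOn_id
  mapsTo := fun _ hz => hz
  mapsTo_inv := fun _ hz => hz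
  left_inv := fun _ _ => rfl
  right_inv := fun _ _ => rfl
  map_zero := rfl
  map_zero_inv := rfl

theorem symm (hg : IsCenteredAut D g g') : IsCenteredAut D g' g where
  differentiableOn := hg.differentiableOn_inv
  differentiableOn_inv := hg.differentiableOn
  mapsTo := hg.mapsTo_inv
  mapsTo_inv := hg.mapsTo
  left_inv := hg.right_inv
  right_inv := hg.left_inv
  map_zero := hg.map_zero_inv
  map_zero_inv := hg.map_zero

theorem comp (hg : IsCenteredAut D g g') (hh : IsCenteredAut D h h') :
    IsCenteredAut D (fun z => g (h z)) (fun z => h' (g' z)) where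
  differentiableOn := hg.differentiableOn.comp hh.differentiableOn hh.mapsTo
  differentiableOn_inv := hh.differentiableOn_inv.comp hg.differentiableOn_inv hg.mapsTo_inv
  mapsTo := hg.mapsTo.comp hh.mapsTo
  mapsTo_inv := hh.mapsTo_inv.comp hg.mapsTo_inv
  left_inv := fun z hz => by rw [hg.left_inv _ (hh.mapsTo hz), hh.left_inv z hz]
  right_inv := fun z hz => by rw [hh.right_inv _ (hg.mapsTo_inv hz), hg.right_inv z hz]
  map_zero := by rw [hh.map_zero, hg.map_zero]
  map_zero_inv := by rw [hg.map_zero_inv, hh.map_zero_inv]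

theorem differentiableAt_zero (hg : IsCenteredAut D g g') (hD : IsOpen D) (h0 : 0 ∈ D) :
    DifferentiableAt ℂ g 0 :=
  hg.differentiableOn.differentiableAt (hD.mem_nhds h0)

theorem fderiv_comp (hg : IsCenteredAut D g g') (hh : IsCenteredAut D h h') (hD : IsOpen D)
    (h0 : 0 ∈ D) :
    fderiv ℂ (fun z => g (h z)) 0 = (fderiv ℂ g 0).comp (fderiv ℂ h 0) := by
  have h1 : HasFDerivAt g (fderiv ℂ g 0) (h 0) := by
    rw [hh.map_zero]; exact (hg.differentiableAt_zero hD h0).hasFDerivAt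
  exact (h1.comp 0 (hh.differentiableAt_zero hD h0).hasFDerivAt).fderiv

theorem fderiv_inv_comp (hg : IsCenteredAut D g g') (hD : IsOpen D) (h0 : 0 ∈ D) :
    (fderiv ℂ g' 0).comp (fderiv ℂ g 0) = ContinuousLinearMap.id ℂ _ := by
  rw [← hg.symm.fderiv_comp hg hD h0]
  have : (fun z => g' (g z)) =ᶠ[𝓝 0] fun z => z := by
    filter_upwards [hD.mem_nhds h0] with z hz
    exact hg.left_inv z hz
  rw [this.fderiv_eq]
  exact fderiv_fun_id

theorem jetEq_one (hg : IsCenteredAut D g g') (hD : IsOpen D) (h0 : 0 ∈ D) :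
    JetEq 1 g (fderiv ℂ g 0) := by
  have := (hg.differentiableAt_zero hD h0).hasFDerivAt.isLittleO
  simp only [hg.map_zero, sub_zero] at this
  refine this.norm_right.congr_right fun z => ?_
  rw [pow_one]

theorem norm_fderiv_le (hg : IsCenteredAut D g g') {R B : ℝ} (hR : 0 < R) (hRD : ball 0 R ⊆ D)
    (hB : ∀ z ∈ D, ‖z‖ ≤ B) : ‖fderiv ℂ g 0‖ ≤ 2 * B / R :=
  norm_fderiv_le_of_norm_le hR (hg.differentiableOn.mono hRD) fun _ hz =>
    hB _ (hg.mapsTo (hRD hz))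

end IsCenteredAut

/-! ### Polynomial maps as a model of jets -/

/-- Polynomial maps of `ℂ^n` whose components have degree at most `k`. -/
abbrev PolyMap (n k : ℕ) : Type := Fin n → MvPolynomial.restrictTotalDegree (Fin n) ℂ k

namespace PolyMap

variable {n k : ℕ}

/-- The map `ℂ^n → ℂ^n` defined by a tuple of polynomials. -/
noncomputable def toMap (v : PolyMap n k) (z : Fin n → ℂ) : Fin n → ℂ :=
  fun i => MvPolynomial.eval z (v i : MvPolynomial (Fin n) ℂ)

theorem totalDegree_le (v : PolyMap n k) (i : Fin n) :
    (v i : MvPolynomial (Fin n) ℂ).totalDegree ≤ k :=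
  (MvPolynomial.mem_restrictTotalDegree _ _ _).1 (v i).2

theorem toMap_add (v w : PolyMap n k) (z : Fin n → ℂ) :
    (v + w).toMap z = v.toMap z + w.toMap z := by
  ext i; simp [toMap]

theorem toMap_sub (v w : PolyMap n k) (z : Fin n → ℂ) :
    PolyMap.toMap (v - w) z = v.toMap z - w.toMap z := by
  ext i; simp [toMap]

theorem toMap_smul (c : ℂ) (v : PolyMap n k) (z : Fin n → ℂ) :
    PolyMap.toMap (c • v) z = c • v.toMap z := by
  ext i; simp [toMap]

theorem continuous_toMap (v : PolyMap n k) : Continuous v.toMap :=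
  continuous_pi fun _ => MvPolynomial.continuous_eval _

theorem differentiable_eval (P : MvPolynomial (Fin n) ℂ) :
    Differentiable ℂ fun z : Fin n → ℂ => MvPolynomial.eval z P := by
  induction P using MvPolynomial.induction_on with
  | C a => simp
  | add p q hp hq =>
    simp only [map_add]
    exact hp.fun_add hq
  | mul_X p i hp =>
    simp only [map_mul, MvPolynomial.eval_X]
    exact hp.fun_mul (differentiable_pi.1 differentiable_id i)

theorem differentiable_toMap (v : PolyMap n k) : Differentiable ℂ v.toMap :=
  differentiable_pi.2 fun _ => differentiable_eval _

theorem ext_of_jetEq {v w : PolyMap n k} (h : JetEq k v.toMap w.toMap) : v = w := by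
  funext i
  exact Subtype.ext (eq_of_jetEq (v.totalDegree_le i) (w.totalDegree_le i) (JetEq.pi_iff.1 h i))

theorem exists_jetEq {R M : ℝ} (hR : 0 < R) {u : (Fin n → ℂ) → (Fin n → ℂ)}
    (hu : DifferentiableOn ℂ u (ball 0 R)) (hM : ∀ z ∈ ball (0 : Fin n → ℂ) R, ‖u z‖ ≤ M) :
    ∃ v : PolyMap n k, JetEq k v.toMap u := by
  have : ∀ i, ∃ T : MvPolynomial (Fin n) ℂ, T.totalDegree ≤ k ∧
      JetEq k (fun z => u z i) fun z => MvPolynomial.eval z T := fun i =>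
    exists_taylor_mvPolynomial hR k (differentiableOn_pi.1 hu i)
      fun z hz => (norm_le_pi_norm _ i).trans (hM z hz)
  choose T hT hj using this
  exact ⟨fun i => ⟨T i, (MvPolynomial.mem_restrictTotalDegree _ _ _).2 (hT i)⟩,
    JetEq.pi_iff.2 fun i => (hj i).symm⟩

theorem norm_toMap_le_of_jetEq {R M : ℝ} {u : (Fin n → ℂ) → (Fin n → ℂ)} {v : PolyMap n k}
    (hu : DifferentiableOn ℂ u (ball 0 R)) (hM : ∀ z ∈ ball (0 : Fin n → ℂ) R, ‖u z‖ ≤ M)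
    (h : JetEq k v.toMap u) {z : Fin n → ℂ} (hz : z ∈ ball 0 R) (i : Fin n) :
    ‖v.toMap z i‖ ≤ (k + 1) * M :=
  norm_eval_le_of_jetEq (v.totalDegree_le i) (differentiableOn_pi.1 hu i)
    (fun z hz => (norm_le_pi_norm _ i).trans (hM z hz)) (JetEq.pi_iff.1 h.symm i) hz

end PolyMap

/-! ### The bounded action on jets and its fixed point -/

/-- The linear maps of `PolyMap n k` induced on `k`-jets by `v ↦ dg(0)⁻¹ ∘ v ∘ g`, for `g` an
automorphism of `D` fixing the origin. -/
def jetActions {n : ℕ} (D : Set (Fin n → ℂ)) (k : ℕ) : Set (PolyMap n k →ₗ[ℂ] PolyMap n k) :=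
  {L | ∃ g g', IsCenteredAut D g g' ∧
    ∀ v, JetEq k (L v).toMap fun z => fderiv ℂ g' 0 (v.toMap (g z))}

section jetActions

variable {n k : ℕ} {D : Set (Fin n → ℂ)} {g g' : (Fin n → ℂ) → (Fin n → ℂ)}

theorem id_mem_jetActions : LinearMap.id ∈ jetActions D k := by
  refine ⟨_, _, IsCenteredAut.id D, fun v => ?_⟩
  have : fderiv ℂ (fun z : Fin n → ℂ => z) 0 = ContinuousLinearMap.id ℂ _ := fderiv_fun_id
  simp only [this]
  exact JetEq.refl _

/-- The action is by precomposition, so the order is reversed: if `L`, `L'` come from `g`, `h`, then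
`L ∘ₗ L'` comes from `h ∘ g`. -/
theorem comp_mem_jetActions (hD : IsOpen D) (h0 : 0 ∈ D) {L L' : PolyMap n k →ₗ[ℂ] PolyMap n k}
    (hL : L ∈ jetActions D k) (hL' : L' ∈ jetActions D k) : L ∘ₗ L' ∈ jetActions D k := by
  obtain ⟨g, g', hg, hLg⟩ := hL
  obtain ⟨h, h', hh, hLh⟩ := hL'
  refine ⟨_, _, hh.comp hg, fun v => ?_⟩
  rw [hg.symm.fderiv_comp hh.symm hD h0]
  refine (hLg (L' v)).trans ?_
  exact ((hLh v).comp (hg.differentiableAt_zero hD h0) hg.map_zero).clm_apply (fderiv ℂ g' 0)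

/-- The bound is uniform in `g`: Cauchy's estimate controls `dg(0)⁻¹` by the size of `D`, and `v` is
bounded on the compact closure of `D`. -/
theorem exists_bound_fderiv_toMap (hbdd : Bornology.IsBounded D) {R : ℝ} (hR : 0 < R)
    (hRD : ball 0 R ⊆ D) (v : PolyMap n k) :
    ∃ M : ℝ, ∀ g g', IsCenteredAut D g g' → ∀ z ∈ D, ‖fderiv ℂ g' 0 (v.toMap (g z))‖ ≤ M := by
  obtain ⟨B, hB⟩ := hbdd.exists_norm_le
  have hc : IsCompact (closure D) := hbdd.isCompact_closure
  obtain ⟨A, hA⟩ := hc.exists_bound_of_continuousOn v.continuous_toMap.continuousOn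
  refine ⟨2 * B / R * A, fun g g' hg z hz => ?_⟩
  refine (ContinuousLinearMap.le_opNorm _ _).trans ?_
  have h1 := hg.symm.norm_fderiv_le hR hRD hB
  exact mul_le_mul h1 (hA _ (subset_closure (hg.mapsTo hz))) (norm_nonneg _)
    ((norm_nonneg _).trans h1)

theorem differentiableOn_fderiv_toMap (hg : IsCenteredAut D g g') (v : PolyMap n k) :
    DifferentiableOn ℂ (fun z => fderiv ℂ g' 0 (v.toMap (g z))) D :=
  (fderiv ℂ g' 0).differentiable.comp_differentiableOn
    (v.differentiable_toMap.comp_differentiableOn hg.differentiableOn)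

theorem exists_mem_jetActions (hD : IsOpen D) (h0 : 0 ∈ D) (hbdd : Bornology.IsBounded D)
    (hg : IsCenteredAut D g g') :
    ∃ L ∈ jetActions D k, ∀ v : PolyMap n k,
      JetEq k (L v).toMap fun z => fderiv ℂ g' 0 (v.toMap (g z)) := by
  obtain ⟨R, hR, hRD⟩ := Metric.isOpen_iff.1 hD 0 h0
  have hex : ∀ v : PolyMap n k, ∃ w : PolyMap n k,
      JetEq k w.toMap fun z => fderiv ℂ g' 0 (v.toMap (g z)) := by
    intro v
    obtain ⟨M, hM⟩ := exists_bound_fderiv_toMap hbdd hR hRD v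
    exact PolyMap.exists_jetEq hR ((differentiableOn_fderiv_toMap hg v).mono hRD)
      fun z hz => hM g g' hg z (hRD hz)
  choose L hL using hex
  -- Linearity is automatic, because a polynomial map of degree at most `k` is determined by its
  -- `k`-jet.
  let L' : PolyMap n k →ₗ[ℂ] PolyMap n k :=
    { toFun := L
      map_add' := fun v w => PolyMap.ext_of_jetEq <| by
        refine (hL (v + w)).trans ?_
        simp only [PolyMap.toMap_add, map_add]
        have h1 := (hL v).add (hL w)
        simp only [← PolyMap.toMap_add] at h1
        exact h1.symm
      map_smul' := fun c v => PolyMap.ext_of_jetEq <| by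
        refine (hL (c • v)).trans ?_
        simp only [PolyMap.toMap_smul, map_smul, RingHom.id_apply]
        have h1 := (hL v).clm_apply (c • ContinuousLinearMap.id ℂ (Fin n → ℂ))
        simp only [smul_apply, ContinuousLinearMap.id_apply, ← PolyMap.toMap_smul] at h1
        exact h1.symm }
  exact ⟨L', ⟨g, g', hg, hL⟩, hL⟩

theorem exists_inv_mem_jetActions (hD : IsOpen D) (h0 : 0 ∈ D) (hbdd : Bornology.IsBounded D)
    {L : PolyMap n k →ₗ[ℂ] PolyMap n k} (hL : L ∈ jetActions D k) :
    ∃ L' ∈ jetActions D k, L' ∘ₗ L = LinearMap.id := by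
  obtain ⟨g, g', hg, hLg⟩ := hL
  obtain ⟨L', hL', hLg'⟩ := exists_mem_jetActions (k := k) hD h0 hbdd hg.symm
  refine ⟨L', hL', LinearMap.ext fun v => PolyMap.ext_of_jetEq ?_⟩
  refine (hLg' (L v)).trans ?_
  refine (((hLg v).comp (hg.symm.differentiableAt_zero hD h0) hg.map_zero_inv).clm_apply
    (fderiv ℂ g 0)).trans (JetEq.of_eventuallyEq ?_)
  filter_upwards [hD.mem_nhds h0] with z hz
  rw [hg.right_inv z hz, ← ContinuousLinearMap.comp_apply, hg.symm.fderiv_inv_comp hD h0]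
  rfl

/-- A polynomial map tangent to the identity that linearizes, up to order `k`, all the automorphisms
of a bounded domain that fix the origin. -/
theorem exists_linearizing_jet (hD : IsOpen D) (h0 : 0 ∈ D) (hbdd : Bornology.IsBounded D)
    (hk : 1 ≤ k) :
    ∃ σ : PolyMap n k, JetEq 1 σ.toMap (fun z => z) ∧ ∀ g g', IsCenteredAut D g g' →
      JetEq k σ.toMap fun z => fderiv ℂ g' 0 (σ.toMap (g z)) := by
  obtain ⟨R, hR, hRD⟩ := Metric.isOpen_iff.1 hD 0 h0
  -- With `x₀` the identity map, `x₀ + W` consists of the maps tangent to the identity. It is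
  -- invariant because `dg(0)⁻¹ ∘ g` is itself tangent to the identity.
  let W : Submodule ℂ (PolyMap n k) :=
    { carrier := {v | JetEq 1 v.toMap 0}
      add_mem' := fun {v w} hv hw => by
        have := JetEq.add hv hw
        simp only [Pi.zero_apply, add_zero, ← PolyMap.toMap_add] at this
        exact this
      zero_mem' := JetEq.of_eventuallyEq (Eventually.of_forall fun z => by
        ext i; simp [PolyMap.toMap])
      smul_mem' := fun c v hv => by
        have := JetEq.clm_apply (c • ContinuousLinearMap.id ℂ (Fin n → ℂ)) hv
        simp only [Pi.zero_apply, map_zero, smul_apply,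
          ContinuousLinearMap.id_apply, ← PolyMap.toMap_smul] at this
        exact this }
  let x₀ : PolyMap n k := fun i => ⟨MvPolynomial.X i,
    (MvPolynomial.mem_restrictTotalDegree _ _ _).2 (by rwa [MvPolynomial.totalDegree_X])⟩
  have hx₀ : ∀ z, x₀.toMap z = z := fun z => by ext i; simp [x₀, PolyMap.toMap]
  have hW : ∀ v, v - x₀ ∈ W ↔ JetEq 1 v.toMap fun z => z := by
    intro v
    change JetEq 1 (PolyMap.toMap (v - x₀)) 0 ↔ _
    unfold JetEq
    simp only [PolyMap.toMap_sub, hx₀, Pi.zero_apply, sub_zero]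
  let ev : ball (0 : Fin n → ℂ) R × Fin n → Module.Dual ℂ (PolyMap n k) := fun p =>
    { toFun := fun v => v.toMap p.1 p.2
      map_add' := fun v w => by rw [PolyMap.toMap_add]; rfl
      map_smul' := fun c v => by rw [PolyMap.toMap_smul]; rfl }
  obtain ⟨σ, hσ, hfix⟩ := exists_fixedPoint_of_pointwise_bounded (jetActions D k)
    id_mem_jetActions (fun L hL L' hL' => comp_mem_jetActions hD h0 hL hL')
    (fun L hL => exists_inv_mem_jetActions hD h0 hbdd hL) ev
    (by
      intro v hv
      refine PolyMap.ext_of_jetEq (JetEq.of_eventuallyEq ?_)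
      filter_upwards [ball_mem_nhds 0 hR] with z hz
      ext i
      have : v.toMap z i = 0 := hv ⟨⟨z, hz⟩, i⟩
      rw [this]; simp [PolyMap.toMap])
    (by
      rintro ⟨z, i⟩ v
      obtain ⟨M, hM⟩ := exists_bound_fderiv_toMap hbdd hR hRD v
      refine ⟨(k + 1) * M, ?_⟩
      rintro L ⟨g, g', hg, hL⟩
      exact PolyMap.norm_toMap_le_of_jetEq ((differentiableOn_fderiv_toMap hg v).mono hRD)
        (fun z hz => hM g g' hg z (hRD hz)) (hL v) z.2 i)
    W x₀
    (by
      rintro L ⟨g, g', hg, hL⟩ v hv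
      rw [hW] at hv ⊢
      refine ((hL v).mono hk).trans ?_
      have h1 := (hv.comp (hg.differentiableAt_zero hD h0) hg.map_zero).clm_apply (fderiv ℂ g' 0)
      refine h1.trans (((hg.jetEq_one hD h0).clm_apply (fderiv ℂ g' 0)).trans ?_)
      refine JetEq.of_eventuallyEq (Eventually.of_forall fun z => ?_)
      dsimp only
      rw [← ContinuousLinearMap.comp_apply, hg.fderiv_inv_comp hD h0]
      rfl)
  refine ⟨σ, (hW σ).1 hσ, fun g g' hg => ?_⟩
  obtain ⟨L, hL, hLg⟩ := exists_mem_jetActions (k := k) hD h0 hbdd hg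
  have := hLg σ
  rwa [hfix L hL] at this

end jetActions

/-! ### Weights of monomials -/

section weights

variable {n k : ℕ}

/-- Both sides have degree at most `k`, so the relation holds exactly; comparing coefficients gives
`P_α (c^α - μ) = 0`. -/
theorem coeff_eq_zero_of_jetEq_scale {P : MvPolynomial (Fin n) ℂ} (hP : P.totalDegree ≤ k)
    {c : Fin n → ℂ} {μ : ℂ}
    (h : JetEq k (fun z => MvPolynomial.eval (fun i => c i * z i) P)
      fun z => μ * MvPolynomial.eval z P) {α : Fin n →₀ ℕ} (hα : ∏ i, c i ^ α i ≠ μ) :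
    P.coeff α = 0 := by
  classical
  set Q : MvPolynomial (Fin n) ℂ :=
    ∑ α ∈ P.support, MvPolynomial.monomial α (P.coeff α * (∏ i, c i ^ α i - μ)) with hQ
  have hQd : Q.totalDegree ≤ k := by
    refine MvPolynomial.totalDegree_finsetSum_le fun α hα => ?_
    exact (MvPolynomial.totalDegree_monomial_le _ _).trans ((MvPolynomial.le_totalDegree hα).trans hP)
  have hQe : ∀ z, MvPolynomial.eval z Q =
      MvPolynomial.eval (fun i => c i * z i) P - μ * MvPolynomial.eval z P := by
    intro z
    rw [eval_eq_sum_support _ P, eval_eq_sum_support _ P, Finset.mul_sum, ← Finset.sum_sub_distrib, hQ,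
      map_sum]
    refine Finset.sum_congr rfl fun α _ => ?_
    rw [MvPolynomial.eval_monomial, Finsupp.prod_fintype _ _ fun _ => pow_zero _]
    simp only [mul_pow, Finset.prod_mul_distrib]
    ring
  have hQ0 : Q = 0 := eq_zero_of_jetEq_zero hQd (by
    unfold JetEq
    simp only [hQe, Pi.zero_apply, sub_zero]
    exact h)
  have h1 : Q.coeff α = P.coeff α * (∏ i, c i ^ α i - μ) := by
    rw [hQ, MvPolynomial.coeff_sum]
    simp only [MvPolynomial.coeff_monomial, Finset.sum_ite_eq', MvPolynomial.mem_support_iff,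
      ite_not]
    split_ifs with h
    · rw [h, zero_mul]
    · rfl
  rw [hQ0, MvPolynomial.coeff_zero] at h1
  exact (mul_eq_zero.1 h1.symm).resolve_right (sub_ne_zero.2 hα)

theorem coeff_eq_zero_of_jetEq_zero {P : MvPolynomial (Fin n) ℂ}
    (h : JetEq k (fun z => MvPolynomial.eval z P) 0) {α : Fin n →₀ ℕ} (hα : α.degree ≤ k) :
    P.coeff α = 0 := by
  obtain ⟨Q, hQ, hcoeff, hj⟩ := exists_jetEq_totalDegree_le k P
  rw [← hcoeff α hα, eq_zero_of_jetEq_zero hQ (hj.symm.trans h), MvPolynomial.coeff_zero]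

theorem exists_circle_pow_ne {p q : ℕ} (h : p ≠ q) : ∃ t : Circle, (t : ℂ) ^ p ≠ (t : ℂ) ^ q := by
  wlog hpq : p < q generalizing p q
  · obtain ⟨t, ht⟩ := this h.symm (lt_of_le_of_ne (not_lt.1 hpq) h.symm)
    exact ⟨t, ht.symm⟩
  obtain ⟨d, rfl⟩ := Nat.exists_eq_add_of_lt hpq
  -- With `q = p + d + 1`, this `t` has `t ^ (d + 1) = -1`, hence `t ^ q = -t ^ p`.
  refine ⟨Circle.exp (Real.pi / (d + 1)), fun heq => ?_⟩
  have hd : ((d : ℂ) + 1) ≠ 0 := by exact_mod_cast Nat.succ_ne_zero d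
  have h1 : ((Circle.exp (Real.pi / (d + 1)) : Circle) : ℂ) ^ (d + 1) = -1 := by
    rw [Circle.coe_exp, ← Complex.exp_nat_mul, ← Complex.exp_pi_mul_I]
    congr 1
    push_cast
    field_simp
  rw [add_assoc, pow_add, h1] at heq
  have h2 : ((Circle.exp (Real.pi / (d + 1)) : Circle) : ℂ) ^ p ≠ 0 := pow_ne_zero _ (by simp)
  have h3 : (1 : ℂ) = -1 := mul_left_cancel₀ h2 (by rw [mul_one]; exact heq)
  norm_num at h3

/-- The diagonal linear map with entries `c`. -/
noncomputable def diagonalCLM (c : Fin n → ℂ) : (Fin n → ℂ) →L[ℂ] (Fin n → ℂ) :=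
  ContinuousLinearMap.pi fun i =>
    c i • ContinuousLinearMap.proj (R := ℂ) (φ := fun _ : Fin n => ℂ) i

@[simp]
theorem diagonalCLM_apply (c z : Fin n → ℂ) (i : Fin n) : diagonalCLM c z i = c i * z i := rfl

theorem isCenteredAut_diagonal {D : Set (Fin n → ℂ)} {m : Fin n → ℕ}
    (hinv : ∀ t : Circle, ∀ z ∈ D, (fun i => (t : ℂ) ^ m i * z i) ∈ D) (t : Circle) :
    IsCenteredAut D (diagonalCLM fun i => (t : ℂ) ^ m i)
      (diagonalCLM fun i => ((t⁻¹ : Circle) : ℂ) ^ m i) where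
  differentiableOn := (diagonalCLM _).differentiable.differentiableOn
  differentiableOn_inv := (diagonalCLM _).differentiable.differentiableOn
  mapsTo := fun z hz => hinv t z hz
  mapsTo_inv := fun z hz => hinv t⁻¹ z hz
  left_inv := fun z _ => by ext i; simp
  right_inv := fun z _ => by ext i; simp
  map_zero := map_zero _
  map_zero_inv := map_zero _

variable {D : Set (Fin n → ℂ)} {m : Fin n → ℕ} {σ : PolyMap n k}

/-- The rotations are automorphisms equal to their own derivatives, so `σ` commutes with them. A
monomial of `σ_i` is then scaled both by `t` to its weight and by `t ^ m i`, for every `t`. -/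
theorem weight_eq_of_coeff_ne_zero
    (hinv : ∀ t : Circle, ∀ z ∈ D, (fun i => (t : ℂ) ^ m i * z i) ∈ D)
    (hσ : ∀ g g', IsCenteredAut D g g' → JetEq k σ.toMap fun z => fderiv ℂ g' 0 (σ.toMap (g z)))
    (i : Fin n) {α : Fin n →₀ ℕ} (hα : (σ i : MvPolynomial (Fin n) ℂ).coeff α ≠ 0) :
    ∑ j, m j * α j = m i := by
  by_contra hne
  obtain ⟨t, ht⟩ := exists_circle_pow_ne hne
  refine hα (coeff_eq_zero_of_jetEq_scale (σ.totalDegree_le i) (c := fun j => (t : ℂ) ^ m j)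
    (μ := (t : ℂ) ^ m i) ?_ ?_)
  · have h1 := hσ _ _ (isCenteredAut_diagonal hinv t)
    rw [ContinuousLinearMap.fderiv] at h1
    have h2 := JetEq.pi_iff.1 (h1.clm_apply (diagonalCLM fun i => (t : ℂ) ^ m i)).symm i
    refine JetEq.trans (JetEq.of_eventuallyEq (Eventually.of_forall fun z => ?_)) h2
    simp only [diagonalCLM_apply, ← mul_assoc, ← mul_pow]
    simp only [PolyMap.toMap, Circle.coe_inv, ne_eq, Circle.coe_ne_zero, not_false_eq_true,
      mul_inv_cancel₀, one_pow, one_mul]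
    rfl
  · simpa only [← pow_mul, Finset.prod_pow_eq_pow_sum] using ht

theorem mul_totalDegree_le_of_weight {m₀ d : ℕ} (hpos : 0 < m₀) (hm₀ : ∀ i, m₀ ≤ m i)
    {P : MvPolynomial (Fin n) ℂ} (hP : ∀ α, P.coeff α ≠ 0 → ∑ j, m j * α j = d) :
    m₀ * P.totalDegree ≤ d := by
  rw [mul_comm, ← Nat.le_div_iff_mul_le hpos]
  refine Finset.sup_le fun α hα => ?_
  rw [Nat.le_div_iff_mul_le hpos, ← hP α (MvPolynomial.mem_support_iff.1 hα),
    Finsupp.sum_fintype _ _ fun _ => rfl, Finset.sum_mul]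
  refine Finset.sum_le_sum fun j _ => ?_
  rw [mul_comm]
  exact Nat.mul_le_mul_right _ (hm₀ j)

/-- Positivity of the weights makes the recursion for `f_i` well-founded: any further factor besides
`z_j` adds weight. -/
theorem weight_lt_of_two_le_degree (hm : ∀ i, 0 < m i) {α : Fin n →₀ ℕ} (hα : 2 ≤ α.degree)
    {j : Fin n} (hj : α j ≠ 0) : m j < ∑ l, m l * α l := by
  rw [Finsupp.degree_eq_sum] at hα
  rw [← Finset.add_sum_erase _ _ (Finset.mem_univ j)] at hα ⊢
  have h1 : ∑ l ∈ Finset.univ.erase j, α l ≤ ∑ l ∈ Finset.univ.erase j, m l * α l :=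
    Finset.sum_le_sum fun l _ => Nat.le_mul_of_pos_left _ (hm l)
  have h2 := hm j
  rcases Nat.lt_or_ge (α j) 2 with h3 | h3
  · have : α j = 1 := by omega
    rw [this] at hα ⊢
    omega
  · have : m j * 2 ≤ m j * α j := Nat.mul_le_mul_left _ h3
    omega

theorem coeff_sub_X_eq_zero (hσ1 : JetEq 1 σ.toMap fun z => z) (i : Fin n) {α : Fin n →₀ ℕ}
    (hα : α.degree ≤ 1) :
    ((σ i : MvPolynomial (Fin n) ℂ) - MvPolynomial.X i).coeff α = 0 := by
  refine coeff_eq_zero_of_jetEq_zero ?_ hα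
  have := JetEq.pi_iff.1 hσ1 i
  refine IsLittleO.congr_left this fun z => ?_
  simp [PolyMap.toMap]

theorem coeff_X_eq_zero_of_two_le_degree (i : Fin n) {α : Fin n →₀ ℕ} (hα : 2 ≤ α.degree) :
    (MvPolynomial.X i : MvPolynomial (Fin n) ℂ).coeff α = 0 := by
  classical
  rw [MvPolynomial.coeff_X, if_neg]
  rintro rfl
  rw [Finsupp.degree_single] at hα
  omega

/-! ### Degree bounds by recursion on the weight -/

/-- The components of an automorphism fixing the origin agree to order `k` with polynomials of
controlled degree. -/
theorem exists_jetEq_component_of_linearizing (hD : IsOpen D) (h0 : 0 ∈ D) {m₀ m₁ : ℕ}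
    (hm₀ : 0 < m₀) (hm : ∀ i, m₀ ≤ m i) (hm₁ : ∀ i, m i ≤ m₁)
    (hinv : ∀ t : Circle, ∀ z ∈ D, (fun i => (t : ℂ) ^ m i * z i) ∈ D)
    (hσ1 : JetEq 1 σ.toMap fun z => z)
    (hσ : ∀ g g', IsCenteredAut D g g' → JetEq k σ.toMap fun z => fderiv ℂ g' 0 (σ.toMap (g z)))
    {f f' : (Fin n → ℂ) → (Fin n → ℂ)} (hf : IsCenteredAut D f f') (i : Fin n) :
    ∃ Q : MvPolynomial (Fin n) ℂ, m₀ ^ 2 * Q.totalDegree ≤ m i * m₁ ∧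
      JetEq k (fun z => f z i) fun z => MvPolynomial.eval z Q := by
  classical
  induction hd : m i using Nat.strong_induction_on generalizing i with
  | _ d ih =>
  subst hd
  -- The smaller-weight condition is moved inside the existential so that `Q` can be chosen for all
  -- `j`; the value 0 at the other indices only ever enters with exponent zero.
  have ih' : ∀ j, ∃ Q : MvPolynomial (Fin n) ℂ, m j < m i →
      m₀ ^ 2 * Q.totalDegree ≤ m j * m₁ ∧
      JetEq k (fun z => f z j) fun z => MvPolynomial.eval z Q := by
    intro j
    by_cases hj : m j < m i
    · obtain ⟨Q, hQ⟩ := ih (m j) hj j rfl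
      exact ⟨Q, fun _ => hQ⟩
    · exact ⟨0, fun h => absurd h hj⟩
  choose Q hQ using ih'
  set A := fderiv ℂ f 0 with hA
  set q : MvPolynomial (Fin n) ℂ := (σ i : MvPolynomial (Fin n) ℂ) - MvPolynomial.X i with hq
  have hqdeg : ∀ α ∈ q.support, 2 ≤ α.degree := by
    intro α hα
    by_contra hlt
    exact MvPolynomial.mem_support_iff.1 hα (coeff_sub_X_eq_zero hσ1 i (by omega))
  have hqw : ∀ α ∈ q.support, ∑ j, m j * α j = m i := by
    intro α hα
    refine weight_eq_of_coeff_ne_zero hinv hσ i ?_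
    have h1 := MvPolynomial.mem_support_iff.1 hα
    rwa [hq, MvPolynomial.coeff_sub, coeff_X_eq_zero_of_two_le_degree i (hqdeg α hα),
      sub_zero] at h1
  have hqlt : ∀ α ∈ q.support, ∀ j, α j ≠ 0 → m j < m i := by
    intro α hα j hj
    rw [← hqw α hα]
    exact weight_lt_of_two_le_degree (fun l => hm₀.trans_le (hm l)) (hqdeg α hα) hj
  -- This is `(A σ)_i - q(Q)`, the relation `f_i = (A σ)_i - q(f)` with the components of `f`
  -- replaced by their polynomial approximations.
  refine ⟨(∑ j, MvPolynomial.C (A (Pi.single j 1) i) * (σ j : MvPolynomial (Fin n) ℂ)) -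
    ∑ α ∈ q.support, MvPolynomial.C (q.coeff α) * ∏ j, Q j ^ α j, ?_, ?_⟩
  · have hpos : 0 < m₀ ^ 2 := by positivity
    rw [mul_comm, ← Nat.le_div_iff_mul_le hpos]
    refine (MvPolynomial.totalDegree_sub _ _).trans (max_le ?_ ?_)
    · refine MvPolynomial.totalDegree_finsetSum_le fun j _ => ?_
      refine (MvPolynomial.totalDegree_mul _ _).trans ?_
      rw [MvPolynomial.totalDegree_C, zero_add, Nat.le_div_iff_mul_le hpos]
      -- The linear part costs one factor `m₀` for the degree of `σ_j`, of weight at most `m₁`; the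
      -- other `m₀` is absorbed by `m₀ ≤ m i`.
      have h1 := mul_totalDegree_le_of_weight hm₀ hm
        (fun α hα => weight_eq_of_coeff_ne_zero hinv hσ j hα)
      calc _ = m₀ * (m₀ * (σ j : MvPolynomial (Fin n) ℂ).totalDegree) := by ring
        _ ≤ m i * m₁ := Nat.mul_le_mul (hm i) (h1.trans (hm₁ j))
    · refine MvPolynomial.totalDegree_finsetSum_le fun α hα => ?_
      refine (MvPolynomial.totalDegree_mul _ _).trans ?_
      rw [MvPolynomial.totalDegree_C, zero_add]
      refine (MvPolynomial.totalDegree_finsetProd _ _).trans ?_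
      -- Writing `m i` as the weight of `α` distributes the bound over the factors, where the
      -- inductive bounds `m j * m₁` add up to exactly `m i * m₁`.
      rw [Nat.le_div_iff_mul_le hpos, ← hqw α hα, Finset.sum_mul, Finset.sum_mul]
      refine Finset.sum_le_sum fun j _ => ?_
      rcases eq_or_ne (α j) 0 with hj | hj
      · simp [hj]
      · have h1 := (hQ j (hqlt α hα j hj)).1
        calc (Q j ^ α j).totalDegree * m₀ ^ 2 ≤ (α j * (Q j).totalDegree) * m₀ ^ 2 :=
              Nat.mul_le_mul_right _ (MvPolynomial.totalDegree_pow _ _)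
          _ = α j * (m₀ ^ 2 * (Q j).totalDegree) := by ring
          _ ≤ α j * (m j * m₁) := Nat.mul_le_mul_left _ h1
          _ = m j * α j * m₁ := by ring
  · have hfd := hf.differentiableAt_zero hD h0
    have hfc : ∀ j, ContinuousAt (fun z => f z j) 0 := fun j =>
      (continuous_apply j).continuousAt.comp hfd.continuousAt
    have hlin : JetEq k (fun z => σ.toMap (f z) i)
        fun z => MvPolynomial.eval z
          (∑ j, MvPolynomial.C (A (Pi.single j 1) i) * (σ j : MvPolynomial (Fin n) ℂ)) := by
      have h1 := JetEq.pi_iff.1 ((hσ f f' hf).clm_apply A).symm i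
      refine (JetEq.of_eventuallyEq (Eventually.of_forall fun z => ?_)).trans
        (h1.trans (JetEq.of_eventuallyEq (Eventually.of_forall fun z => ?_)))
      · rw [← ContinuousLinearMap.comp_apply, hf.symm.fderiv_inv_comp hD h0]
        rfl
      · dsimp only
        nth_rewrite 1 [← Finset.univ_sum_single (σ.toMap z)]
        have h2 : ∀ j, (Pi.single j (σ.toMap z j) : Fin n → ℂ) =
            σ.toMap z j • (Pi.single j 1 : Fin n → ℂ) := fun j => by
          rw [← Pi.single_smul, smul_eq_mul, mul_one]
        simp only [h2, map_sum, map_smul, Finset.sum_apply, Pi.smul_apply, smul_eq_mul, map_mul,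
          MvPolynomial.eval_C]
        exact Finset.sum_congr rfl fun j _ => mul_comm _ _
    have hnl : JetEq k (fun z => MvPolynomial.eval (f z) q)
        fun z => MvPolynomial.eval z
          (∑ α ∈ q.support, MvPolynomial.C (q.coeff α) * ∏ j, Q j ^ α j) := by
      simp only [eval_eq_sum_support _ q, map_sum, map_mul, MvPolynomial.eval_C, map_prod, map_pow]
      refine JetEq.sum fun α hα => JetEq.mul (JetEq.refl _) ?_ ?_ ?_
      · refine JetEq.prod (fun j _ => ?_) (fun j _ => (hfc j).pow _)
          fun j _ => ((MvPolynomial.continuous_eval _).pow _).continuousAt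
        rcases eq_or_ne (α j) 0 with hj | hj
        · simpa [hj] using JetEq.refl _
        · exact (hQ j (hqlt α hα j hj)).2.pow (hfc j)
            (MvPolynomial.continuous_eval _).continuousAt _
      · exact isBigO_one_of_continuousAt continuousAt_const
      · refine isBigO_one_of_continuousAt (Continuous.continuousAt ?_)
        exact continuous_finsetProd _ fun j _ => (MvPolynomial.continuous_eval _).pow _
    refine (JetEq.of_eventuallyEq (Eventually.of_forall fun z => ?_)).trans
      ((hlin.sub hnl).trans (JetEq.of_eventuallyEq (Eventually.of_forall fun z => ?_)))
    · simp [hq, PolyMap.toMap]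
    · simp

theorem exists_eqOn_component (hD : IsOpen D) (hc : IsPreconnected D) (h0 : 0 ∈ D)
    (hbdd : Bornology.IsBounded D) {m₀ m₁ : ℕ}
    (hm₀ : 0 < m₀) (hm : ∀ i, m₀ ≤ m i) (hm₁ : ∀ i, m i ≤ m₁)
    (hinv : ∀ t : Circle, ∀ z ∈ D, (fun i => (t : ℂ) ^ m i * z i) ∈ D)
    {f f' : (Fin n → ℂ) → (Fin n → ℂ)} (hf : IsCenteredAut D f f') (i : Fin n) :
    ∃ Q : MvPolynomial (Fin n) ℂ, m₀ ^ 2 * Q.totalDegree ≤ m i * m₁ ∧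
      ∀ z ∈ D, f z i = MvPolynomial.eval z Q := by
  -- The order is shifted to `k + 1` because tangency to the identity needs jets of order at least
  -- 1.
  have hex : ∀ k, ∃ Q : MvPolynomial (Fin n) ℂ, m₀ ^ 2 * Q.totalDegree ≤ m i * m₁ ∧
      JetEq (k + 1) (fun z => f z i) fun z => MvPolynomial.eval z Q := by
    intro k
    obtain ⟨σ, hσ1, hσ⟩ := exists_linearizing_jet (k := k + 1) hD h0 hbdd (by omega)
    exact exists_jetEq_component_of_linearizing hD h0 hm₀ hm hm₁ hinv hσ1 hσ hf i
  choose Q hQ hj using hex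
  set N := m i * m₁
  have hdeg : ∀ k, (Q k).totalDegree ≤ N + 1 := fun k =>
    ((Nat.le_mul_of_pos_left _ (by positivity)).trans (hQ k)).trans (Nat.le_succ _)
  -- All `Q k` have degree at most `N + 1`, so they coincide once their jets of order `N + 1` are
  -- those of `f_i`.
  have hconst : ∀ k, N ≤ k → Q k = Q N := fun k hk =>
    eq_of_jetEq (hdeg k) (hdeg N) (((hj k).symm.mono (by omega)).trans (hj N))
  refine ⟨Q N, hQ N, ?_⟩
  set h : (Fin n → ℂ) → ℂ := fun z => f z i - MvPolynomial.eval z (Q N) with hh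
  have hd : DifferentiableOn ℂ h D :=
    (differentiableOn_pi.1 hf.differentiableOn i).fun_sub
      (PolyMap.differentiable_eval _).differentiableOn
  have hflat : ∀ k, JetEq k h 0 := by
    intro k
    have h1 : JetEq (max k N + 1) (fun z => f z i) fun z => MvPolynomial.eval z (Q N) := by
      rw [← hconst _ (le_max_right k N)]; exact hj _
    refine IsLittleO.congr_left (h1.mono (by omega : k ≤ max k N + 1)) fun z => ?_
    simp [hh]
  obtain ⟨R, hR, hRD⟩ := Metric.isOpen_iff.1 hD 0 h0
  have hnear : h =ᶠ[𝓝 0] 0 := by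
    filter_upwards [ball_mem_nhds 0 hR] with z hz
    exact eq_zero_of_forall_jetEq_zero (hd.mono hRD) hflat hz
  intro z hz
  exact sub_eq_zero.1 (eqOn_zero_of_isPreconnected hD hc hd h0 hnear z hz)

end weights

/-! ### Positivity of the weights and the change of coordinates -/

theorem torusChar_const {r : ℕ} (k : Fin r → ℤ) (t : Circle) :
    torusChar k (fun _ => t) = (t : ℂ) ^ weightSize k := by
  simp only [torusChar, weightSize]
  induction (Finset.univ : Finset (Fin r)) using Finset.induction_on with
  | empty => simp
  | insert i s hi ih =>
    rw [Finset.prod_insert hi, Finset.sum_insert hi, zpow_add₀ (Circle.coe_ne_zero t), ih]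

/-- A nonnegative weight of size 0 vanishes, and then the coordinate `z_i` is a nonconstant
invariant. -/
theorem weightSize_pos_of_onlyConstantInvariants {r n : ℕ} {ρ : Torus r →* GL (Fin n) ℂ}
    (hρ : OnlyConstantInvariants ρ) {b : Module.Basis (Fin n) ℂ (Fin n → ℂ)}
    {a : Fin n → Fin r → ℤ} (ha : IsDiagonalWithWeights ρ b a) (hnonneg : ∀ i j, 0 ≤ a i j)
    (i : Fin n) : 0 < weightSize (a i) := by
  refine lt_of_le_of_ne (Finset.sum_nonneg fun j _ => hnonneg i j) fun h0 => ?_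
  have hzero : ∀ j, a i j = 0 := fun j =>
    (Finset.sum_eq_zero_iff_of_nonneg fun j _ => hnonneg i j).1 h0.symm j (Finset.mem_univ j)
  obtain ⟨c, hc⟩ := hρ (fun z => b.repr z i)
    (LinearMap.toContinuousLinearMap (b.coord i)).differentiable fun t z => by
      rw [ha t z i, torusChar]
      simp [hzero]
  have h1 := (hc (b i)).trans (hc 0).symm
  simp at h1

theorem proposition6p4 {r n : ℕ} (hn : 0 < n)
    (ρ : Torus r →* GL (Fin n) ℂ) (D : Set (Fin n → ℂ))
    (hD : IsQuasiReinhardt ρ D) (hbdd : Bornology.IsBounded D) (h0 : (0 : Fin n → ℂ) ∈ D)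
    (b : Module.Basis (Fin n) ℂ (Fin n → ℂ)) (a : Fin n → Fin r → ℤ)
    (ha : IsDiagonalWithWeights ρ b a)
    (hnonneg : ∀ i j, 0 ≤ a i j)
    (hmono : Monotone fun i => weightSize (a i))
    (f : (Fin n → ℂ) → (Fin n → ℂ)) (hf : IsHolAutomorphism D f) (hf0 : f 0 = 0) :
    ∃ P : Fin n → MvPolynomial (Fin n) ℂ,
      (∀ z ∈ D, ∀ i, b.repr (f z) i = MvPolynomial.eval (b.repr z) (P i)) ∧
      (∀ i, ((P i).totalDegree : ℝ) ≤
        (weightSize (a i) : ℝ) * (weightSize (a ⟨n - 1, Nat.sub_one_lt_of_lt hn⟩) : ℝ) /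
          (weightSize (a ⟨0, hn⟩) : ℝ) ^ 2) ∧
      (polyMapDegree P : ℝ) ≤
        (weightSize (a ⟨n - 1, Nat.sub_one_lt_of_lt hn⟩) : ℝ) ^ 2 /
          (weightSize (a ⟨0, hn⟩) : ℝ) ^ 2 := by
  set first : Fin n := ⟨0, hn⟩
  set last : Fin n := ⟨n - 1, Nat.sub_one_lt_of_lt hn⟩
  have hpos := weightSize_pos_of_onlyConstantInvariants hD.only_constant_invariants ha hnonneg
  set m : Fin n → ℕ := fun i => (weightSize (a i)).toNat
  have hm : ∀ i, (m i : ℤ) = weightSize (a i) := fun i => Int.toNat_of_nonneg (hpos i).le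
  have hmR : ∀ i, (weightSize (a i) : ℝ) = m i := fun i => by rw [← hm i]; push_cast; rfl
  have hfirst : ∀ i, m first ≤ m i := fun i =>
    Int.toNat_le_toNat (hmono (Fin.mk_le_of_le_val (Nat.zero_le _)))
  have hlast : ∀ i, m i ≤ m last := fun i =>
    Int.toNat_le_toNat (hmono (Fin.le_iff_val_le_val.2 (Nat.le_sub_one_of_lt i.2)))
  have hm0 : 0 < m first := by
    have := hm first
    have := hpos first
    omega
  obtain ⟨hfd, hfm, g, hgd, hgm, hleft, hright⟩ := hf
  set φ : (Fin n → ℂ) ≃L[ℂ] (Fin n → ℂ) := b.equivFun.toContinuousLinearEquiv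
  have hφr : ∀ z i, φ z i = b.repr z i := fun _ _ => rfl
  -- The domain written in the coordinates of `b`, where the action is diagonal.
  set D' : Set (Fin n → ℂ) := φ.symm ⁻¹' D with hD'
  have hD'im : D' = φ '' D := (φ.image_eq_preimage_symm D).symm
  have hmaps : Set.MapsTo φ.symm D' D := fun z hz => hz
  have hmem : ∀ z, z ∈ D → φ z ∈ D' := fun z hz => by
    rw [hD', Set.mem_preimage, φ.symm_apply_apply]; exact hz
  have hF : IsCenteredAut D' (fun z => φ (f (φ.symm z))) (fun z => φ (g (φ.symm z))) :=
    { differentiableOn := φ.differentiable.comp_differentiableOn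
        (hfd.comp φ.symm.differentiable.differentiableOn hmaps)
      differentiableOn_inv := φ.differentiable.comp_differentiableOn
        (hgd.comp φ.symm.differentiable.differentiableOn hmaps)
      mapsTo := fun z hz => hmem _ (hfm hz)
      mapsTo_inv := fun z hz => hmem _ (hgm hz)
      left_inv := fun z hz => by
        rw [φ.symm_apply_apply, hleft hz, φ.apply_symm_apply]
      right_inv := fun z hz => by
        rw [φ.symm_apply_apply, hright hz, φ.apply_symm_apply]
      map_zero := by rw [map_zero, hf0, map_zero]
      map_zero_inv := by
        have : g 0 = 0 := by
          have := hleft h0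
          rwa [hf0] at this
        rw [map_zero, this, map_zero] }
  -- Only the diagonal circle `t ↦ (t, …, t)` of the torus is used; it acts on `z_i` with weight
  -- `|a_i|`.
  have hinv : ∀ t : Circle, ∀ z ∈ D', (fun i => (t : ℂ) ^ m i * z i) ∈ D' := by
    intro t z hz
    have h1 := hmem _ (hD.invariant (fun _ => t) _ hz)
    convert h1 using 1
    ext i
    rw [hφr, ha, torusChar_const, ← hm i, zpow_natCast, ← hφr, φ.apply_symm_apply]
  have hconn : IsPreconnected D' := by
    rw [hD'im]
    exact hD.isConnected.isPreconnected.image _ φ.continuous.continuousOn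
  have hbdd' : Bornology.IsBounded D' := by
    rw [hD'im]
    exact φ.lipschitz.isBounded_image hbdd
  have hmain := exists_eqOn_component (D := D') (hD.isOpen.preimage φ.symm.continuous)
    hconn (by rw [hD', Set.mem_preimage, map_zero]; exact h0) hbdd' hm0 hfirst hlast hinv hF
  choose P hPdeg hP using hmain
  have hm0R : (0 : ℝ) < (m first : ℝ) ^ 2 := by positivity
  refine ⟨P, fun z hz i => ?_, fun i => ?_, ?_⟩
  · have h1 := hP i (φ z) (hmem z hz)
    rw [φ.symm_apply_apply] at h1
    exact h1
  · rw [hmR, hmR, hmR, le_div_iff₀ hm0R, mul_comm]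
    exact_mod_cast hPdeg i
  · rw [hmR, hmR, le_div_iff₀ hm0R]
    have h1 : polyMapDegree P ≤ m last ^ 2 / m first ^ 2 := by
      refine Finset.sup_le fun i _ => ?_
      rw [Nat.le_div_iff_mul_le (by positivity), mul_comm, sq (m last)]
      exact (hPdeg i).trans (Nat.mul_le_mul_right _ (hlast i))
    exact_mod_cast (Nat.le_div_iff_mul_le (by positivity)).1 h1
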